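/- Let $r\ge 0$, let $R$ be a commutative $\mathbb{Q}$-algebra (for instance $\mathbb{C}$, or a polynomial ring in independent variables $a_{g,N}$), and let $a_{g,N}\in R$ be arbitrary coefficients, indexed by integers $g\ge 0$ and multi-indices $N\in\mathbb{Z}_{\ge 0}^r$. Put $U_g(X)=\sum_N a_{g,N}X^N/N!\in R[[x_1,\dots,x_r]]$ and let $H=\left(\partial^2U_0/\partial x_i\partial x_j\right)$ be the Hessian matrix of $U_0$. Let $S=(s_{ij})$ be a symmetric $r\times r$ matrix of independent variables $s_{ij}=s_{ji}$. A bipartite colored modular graph $\Gamma$ is a finite graph (multiple edges allowed) with two kinds of vertices, $a$-vertices and $s$-vertices, and with finitely many tails (edges with only one end). Every edge joins an $a$-vertex to an $s$-vertex, every tail is attached to an $a$-vertex, every $s$-vertex is two-valent, every edge and every tail has a color in $\{1,\dots,r\}$, and every $a$-vertex $v$ has a genus $g(v)\in\mathbb{Z}_{\ge 0}$. Isomorphisms are bijections of the $a$-vertices, $s$-vertices, edges and tails that respect incidence, colors and genera. Put $g(\Gamma)=\sum_v g(v)+b_1(\Gamma)-b_0(\Gamma)+1$, where $b_0,b_1$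 are the Betti numbers. Let $N(\Gamma)$ be the multi-index that counts the tails of each color, let $N(v)$ be the multi-index that counts the edges and tails of each color at an $a$-vertex $v$, and let $\mu(\Gamma)=\prod_{v}a_{g(v),N(v)}\prod_{w}s_{i(w)j(w)}$, where $v$ runs over the $a$-vertices, $w$ over the $s$-vertices, and $i(w),j(w)$ are the colors of the two edges at $w$. The genus $g$ term of the genus expansion is $$\Psi_g(S,X)=\sum_{\Gamma}\frac{1}{|\mathrm{Aut}\,\Gamma|}\,\mu(\Gamma)\,X^{N(\Gamma)}\in R[[S,X]],$$ the sum being over the isomorphism classes of connected bipartite colored modular graphs of genus $g$. Let $\Phi=(\Phi_1,\dots,\Phi_r)$ with $\Phi_i=\partial\Psi_0/\partial x_i$. **Theorem.** The genus-one term of the genus expansion is $$\Psi_1(S,X)=U_1(X+S\Phi)-\tfrac12\operatorname{tr}\ln\bigl(E-S\,H(X+S\Phi)\bigr),\qquad \Phi=\Phi(S,X),$$ where $E$ is the identity matrix and $\ln(E-M)=-\sum_{k\ge1}M^k/k$. Moreover, the series on the right-hand side is the unique solution $\Psi\in R[[S,X]]$ of the equations $$\frac{\partial\Psi}{\partial s_{ij}}=\frac{1}{\{ij\}!}\left[\frac{\partial^2\Psi_0}{\partial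 x_i\partial x_j}+\Phi_i\frac{\partial\Psi}{\partial x_j}+\Phi_j\frac{\partial\Psi}{\partial x_i}\right]\qquad(1\le i,j\le r)$$ with the initial condition $\Psi(0,X)=U_1(X)$, where $\{ij\}!=1$ for $i\ne j$ and $\{ii\}!=2$. -/

import Mathlib

namespace ColoredGraphs

noncomputable section

/-! ### Bipartite colored modular graphs -/

/-- A bipartite colored modular graph with colors in `Fin r`: `A` is the set of `a`-vertices, `S` the
set of `s`-vertices, `E` the set of edges and `T` the set of tails (edges with only one end).
Every edge joins an `a`-vertex to an `s`-vertex, every tail is attached to an `a`-vertex, every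
`s`-vertex is two-valent. Multiple edges are allowed. -/
structure BipGraph (r : ℕ) (A S E T : Type) where
  /-- the end of an edge that is an `a`-vertex -/
  aEnd : E → A
  /-- the end of an edge that is an `s`-vertex -/
  sEnd : E → S
  /-- the `a`-vertex at which a tail is attached -/
  base : T → A
  /-- the coloring of the edges -/
  edgeColor : E → Fin r
  /-- the coloring of the tails -/
  tailColor : T → Fin r
  /-- the genus of an `a`-vertex -/
  vGenus : A → ℕ
  two_valent : ∀ s : S, Nat.card {e : E // sEnd e = s} = 2

namespace BipGraph

variable {r : ℕ} {A S E T A' S' E' T' : Type}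

/-- Isomorphisms: bijections of both kinds of vertices, of edges and of tails that respect
incidence, colors and genera. -/
@[ext] structure Iso (Γ : BipGraph r A S E T) (Γ' : BipGraph r A' S' E' T') where
  onA : A ≃ A'
  onS : S ≃ S'
  onE : E ≃ E'
  onT : T ≃ T'
  aEnd_eq : ∀ e, Γ'.aEnd (onE e) = onA (Γ.aEnd e)
  sEnd_eq : ∀ e, Γ'.sEnd (onE e) = onS (Γ.sEnd e)
  base_eq : ∀ t, Γ'.base (onT t) = onA (Γ.base t)
  edgeColor_eq : ∀ e, Γ'.edgeColor (onE e) = Γ.edgeColor e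
  tailColor_eq : ∀ t, Γ'.tailColor (onT t) = Γ.tailColor t
  vGenus_eq : ∀ v, Γ'.vGenus (onA v) = Γ.vGenus v

/-- The number of automorphisms. -/
def autCard (Γ : BipGraph r A S E T) : ℕ := Nat.card (Iso Γ Γ)

/-- The simple graph on the set of all vertices in which two vertices are adjacent
when some edge joins them. -/
def skeleton (Γ : BipGraph r A S E T) : SimpleGraph (A ⊕ S) :=
  SimpleGraph.fromRel fun v w => ∃ e : E, v = Sum.inl (Γ.aEnd e) ∧ w = Sum.inr (Γ.sEnd e)

/-- The graph is connected (in particular it is not empty). -/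
def IsConnected (Γ : BipGraph r A S E T) : Prop := Γ.skeleton.Connected

/-- The Betti number `b₀`: the number of connected components. -/
def b0 (Γ : BipGraph r A S E T) : ℤ := Nat.card Γ.skeleton.ConnectedComponent

/-- The Betti number `b₁` (the cyclomatic number), edges being counted with multiplicity. -/
def b1 (Γ : BipGraph r A S E T) : ℤ :=
  (Nat.card E : ℤ) - ((Nat.card A : ℤ) + (Nat.card S : ℤ)) + Γ.b0

/-- The genus `∑ g(v) + b₁ - b₀ + 1`. -/
def genus [Fintype A] (Γ : BipGraph r A S E T) : ℤ :=
  (∑ v : A, (Γ.vGenus v : ℤ)) + Γ.b1 - Γ.b0 + 1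

/-- The valence of an `a`-vertex: for each color `i`, the number of edges and tails of
color `i` incident to it. -/
def valence (Γ : BipGraph r A S E T) (v : A) : Fin r →₀ ℕ :=
  Finsupp.equivFunOnFinite.symm fun i =>
    Nat.card {e : E // Γ.aEnd e = v ∧ Γ.edgeColor e = i} +
      Nat.card {t : T // Γ.base t = v ∧ Γ.tailColor t = i}

/-- The number of `s`-vertices whose two incident edges have the colors `i` and `j`,
where `p = {i, j}` is an unordered pair. -/
def sCount (Γ : BipGraph r A S E T) (p : Sym2 (Fin r)) : ℕ :=
  Nat.card {s : S // ∃ e e' : E, e ≠ e' ∧ Γ.sEnd e = s ∧ Γ.sEnd e' = s ∧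
    p = s(Γ.edgeColor e, Γ.edgeColor e')}

/-- The number of tails of color `i`. -/
def tailCount (Γ : BipGraph r A S E T) (i : Fin r) : ℕ :=
  Nat.card {t : T // Γ.tailColor t = i}

/-- The exponent of the monomial `∏ s_{ij} · X^N` of the graph, with one factor `s_{ij}` for each
`s`-vertex whose edges have the colors `i`, `j`, and one factor `x_i` for each tail of color `i`. -/
def exponent (Γ : BipGraph r A S E T) : (Sym2 (Fin r) ⊕ Fin r) →₀ ℕ :=
  Finsupp.equivFunOnFinite.symm (Sum.elim Γ.sCount Γ.tailCount)

/-- The product of the coefficients `a_{g(v), N(v)}` over all `a`-vertices `v`. -/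
def vertexWeight {R : Type*} [CommRing R] [Fintype A] (a : ℕ → (Fin r →₀ ℕ) → R)
    (Γ : BipGraph r A S E T) : R :=
  ∏ v : A, a (Γ.vGenus v) (Γ.valence v)

end BipGraph

/-- Finite bipartite colored modular graphs, with vertices, edges and tails numbered;
up to isomorphism these are all finite graphs. -/
structure FinGraph (r : ℕ) where
  nA : ℕ
  nS : ℕ
  nE : ℕ
  nT : ℕ
  graph : BipGraph r (Fin nA) (Fin nS) (Fin nE) (Fin nT)

/-- Isomorphism of finite graphs. -/
instance FinGraph.setoid (r : ℕ) : Setoid (FinGraph r) where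
  r Γ Γ' := Nonempty (Γ.graph.Iso Γ'.graph)
  iseqv := by
    refine ⟨fun Γ => ⟨⟨Equiv.refl _, Equiv.refl _, Equiv.refl _, Equiv.refl _, ?_, ?_, ?_, ?_, ?_,
      ?_⟩⟩, ?_, ?_⟩
    iterate 6 exact fun _ => rfl
    · rintro Γ Γ' ⟨f⟩
      refine ⟨⟨f.onA.symm, f.onS.symm, f.onE.symm, f.onT.symm, ?_, ?_, ?_, ?_, ?_, ?_⟩⟩
      · intro e
        rw [Equiv.eq_symm_apply, ← f.aEnd_eq, Equiv.apply_symm_apply]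
      · intro e
        rw [Equiv.eq_symm_apply, ← f.sEnd_eq, Equiv.apply_symm_apply]
      · intro t
        rw [Equiv.eq_symm_apply, ← f.base_eq, Equiv.apply_symm_apply]
      · intro e
        rw [← f.edgeColor_eq, Equiv.apply_symm_apply]
      · intro t
        rw [← f.tailColor_eq, Equiv.apply_symm_apply]
      · intro v
        rw [← f.vGenus_eq, Equiv.apply_symm_apply]
    · rintro Γ Γ' Γ'' ⟨f⟩ ⟨h⟩
      refine ⟨⟨f.onA.trans h.onA, f.onS.trans h.onS, f.onE.trans h.onE, f.onT.trans h.onT,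
        ?_, ?_, ?_, ?_, ?_, ?_⟩⟩ <;> intro x
      · simp [h.aEnd_eq, f.aEnd_eq]
      · simp [h.sEnd_eq, f.sEnd_eq]
      · simp [h.base_eq, f.base_eq]
      · simp [h.edgeColor_eq, f.edgeColor_eq]
      · simp [h.tailColor_eq, f.tailColor_eq]
      · simp [h.vGenus_eq, f.vGenus_eq]

/-- Isomorphism classes of finite bipartite colored modular graphs. -/
abbrev GraphClass (r : ℕ) : Type := Quotient (FinGraph.setoid r)

/-- A graph representing an isomorphism class. -/
def GraphClass.rep {r : ℕ} (c : GraphClass r) : FinGraph r := Quotient.out c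

/-! ### Formal power series -/

/-- Formal power series in the variables `x_i`. -/
abbrev XSeries (r : ℕ) (R : Type*) := MvPowerSeries (Fin r) R

/-- Formal power series in the entries `s_{ij} = s_{ji}` of a symmetric matrix (one variable for
each unordered pair of indices) and in the variables `x_i`. -/
abbrev SXSeries (r : ℕ) (R : Type*) := MvPowerSeries (Sym2 (Fin r) ⊕ Fin r) R

section Series

variable {r : ℕ} {R : Type*} [CommRing R]

/-- The factorial `N! = n_1! ⋯ n_r!` of a multi-index. -/
def multiFactorial (N : Fin r →₀ ℕ) : ℕ := ∏ i, (N i).factorial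

/-- The partial derivative `∂/∂x_i` of a series in `x`. -/
def dX (i : Fin r) (f : XSeries r R) : XSeries r R := MvPowerSeries.pderiv R i f

/-- The partial derivative `∂/∂x_i` of a series in `S` and `x`. -/
def dx (i : Fin r) (f : SXSeries r R) : SXSeries r R := MvPowerSeries.pderiv R (Sum.inr i) f

/-- The partial derivative `∂/∂s_{ij}` of a series in `S` and `x`. -/
def ds (i j : Fin r) (f : SXSeries r R) : SXSeries r R :=
  MvPowerSeries.pderiv R (Sum.inl s(i, j)) f

/-- The symmetric matrix `S` of independent variables. -/
def sMatrix (r : ℕ) (R : Type*) [CommRing R] : Matrix (Fin r) (Fin r) (SXSeries r R) :=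
  Matrix.of fun i j => MvPowerSeries.X (Sum.inl s(i, j))

/-- The vector `X` of independent variables. -/
def xVector (r : ℕ) (R : Type*) [CommRing R] : Fin r → SXSeries r R :=
  fun i => MvPowerSeries.X (Sum.inr i)

/-- The value `f(0, X)` of a series `f(S, X)` at `S = 0`. -/
def atSZero (f : SXSeries r R) : XSeries r R :=
  MvPowerSeries.subst (Sum.elim (fun _ => 0) MvPowerSeries.X) f

/-- The vector `Φ(S, X)`: the gradient with respect to `X` of `Ψ₀(S, X)`. -/
def gradient (Psi0 : SXSeries r R) : Fin r → SXSeries r R := fun i => dx i Psi0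

/-- The vector `X + S Φ(S, X)`. -/
def shiftedX (Phi : Fin r → SXSeries r R) : Fin r → SXSeries r R :=
  xVector r R + (sMatrix r R).mulVec Phi

/-- The Hessian matrix of a series in `x`. -/
def hessian (U0 : XSeries r R) : Matrix (Fin r) (Fin r) (XSeries r R) :=
  Matrix.of fun i j => dX i (dX j U0)

variable [Algebra ℚ R]

/-- `U_g(X) = ∑_N a_{g,N} X^N / N!`. -/
def potential (a : ℕ → (Fin r →₀ ℕ) → R) (g : ℕ) : XSeries r R :=
  fun N => (1 / (multiFactorial N : ℚ)) • a g N

/-- The genus `g` term of the genus expansion: the sum of `μ(Γ) X^{N(Γ)} / |Aut Γ|` over all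
isomorphism classes of connected bipartite colored modular graphs `Γ` of genus `g`. For each
monomial only finitely many classes contribute. -/
def genusTerm (a : ℕ → (Fin r →₀ ℕ) → R) (g : ℕ) : SXSeries r R :=
  fun d => ∑ᶠ c ∈ {c : GraphClass r | c.rep.graph.IsConnected ∧
      c.rep.graph.genus = (g : ℤ) ∧ c.rep.graph.exponent = d},
    (1 / (c.rep.graph.autCard : ℚ)) • c.rep.graph.vertexWeight a

/-- The formal logarithm `ln A = ∑_{k ≥ 1} (-1)^{k+1} (A - E)^k / k` of a square matrix of formal
power series, for `A - E` without constant terms; the sum is finite in each coefficient. -/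
def matrixLog {n : Type*} [Fintype n] [DecidableEq n] {σ : Type*}
    (A : Matrix n n (MvPowerSeries σ R)) : Matrix n n (MvPowerSeries σ R) :=
  Matrix.of fun i j d =>
    ∑ᶠ k : ℕ, ((-1 : ℚ) ^ k / ((k : ℚ) + 1)) • MvPowerSeries.coeff d (((A - 1) ^ (k + 1)) i j)

/-- `U₁(X + SΦ) - ½ tr ln (E - S H(X + SΦ))`, with `H` the Hessian matrix of `U₀`. -/
def oneLoop (U0 U1 : XSeries r R) (Phi : Fin r → SXSeries r R) : SXSeries r R :=
  MvPowerSeries.subst (shiftedX Phi) U1 -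
    (1 / 2 : ℚ) • Matrix.trace (matrixLog
      (1 - sMatrix r R * (hessian U0).map (MvPowerSeries.subst (shiftedX Phi))))

/-- The genus one equations for `Ψ₁`, for all `i`, `j`, where `Φ` is the gradient of `Ψ₀`:
`∂Ψ₁/∂s_{ij} = (1/{ij}!) (∂²Ψ₀/∂x_i∂x_j + Φ_i ∂Ψ₁/∂x_j + Φ_j ∂Ψ₁/∂x_i)`. -/
def GenusOneEquations (Psi0 Psi1 : SXSeries r R) : Prop :=
  ∀ i j : Fin r, ds i j Psi1 =
    (1 / (multiFactorial (Finsupp.single i 1 + Finsupp.single j 1) : ℚ)) •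
      (dx i (dx j Psi0) + gradient Psi0 i * dx j Psi1 + gradient Psi0 j * dx i Psi1)

end Series

end

end ColoredGraphs

namespace ColoredGraphs

noncomputable section

/-! ### Calculus of formal power series -/

section Calculus

open MvPowerSeries

variable {σ τ R : Type*} [CommRing R]

/-! The proof has a combinatorial half, which produces differential equations for the genus terms,
and an analytic half, which solves them.

Combinatorial half. The derivative by s_ij marks an `s`-vertex of colors i, j. Cutting it leaves two
new tails, of colors i and j, either on one connected graph with one loop less, or on two connected
graphs whose genera add up to the old one. In genus zero only the second case occurs, and ∂Ψ₀/∂s_ij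
= Φ_iΦ_j/{ij}! (`genusZeroEquations_genusTerm`); in genus one both occur and give the stated
equations (`genusOneEquations_genusTerm`). Automorphisms are removed by labelling: by orbit
counting, d! times the coefficient of a monomial of exponent d is a weighted count of graphs with
labelled `s`-vertices and tails (`factorial_smul_coeff_genusTerm`), with weight 1/m! for numbering
the m `a`-vertices and 1/2 for ordering the two edges at each `s`-vertex. For labelled graphs the
cut is an exact identity (`ite_connectedOn_addPair`, `confSum_addPair`, `labelledSum_option`), and a
formal variable for the genus turns it into a recursion of generating series (`genusSeries_option`).

Analytic half. Let L_ij = ∂/∂s_ij - (Φ_i ∂/∂x_j + Φ_j ∂/∂x_i)/{ij}! (`transport`). A series is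
determined by all its L_ij-images and its value at S = 0 (`eq_zero_of_transport_eq_zero`), which
gives uniqueness. Differentiating the genus zero equations by x_k gives L_ij Φ_k = 0, and then
L_ij(X + SΦ) = 0, so every series in X + SΦ is killed by L_ij. Hence Φ = ∇U₀(X + SΦ), because both
sides are killed and agree at S = 0. Taking Jacobians, Q = ∂(X + SΦ)/∂X is the inverse of E - SH and
the Hessian of Ψ₀ is HQ (`GenusZeroEquations.jacobian_mul`). Therefore L_ij tr ln(E - SH) = -tr(Q
(∂S/∂s_ij) H) = -tr((∂S/∂s_ij) HQ) = -(2/{ij}!) ∂²Ψ₀/∂x_i∂x_j, so -½ tr ln supplies exactly the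
inhomogeneous term. -/

theorem natCast_le_order_subst {Y : σ → MvPowerSeries τ R} (hY : HasSubst Y)
    (h0 : ∀ i, constantCoeff (Y i) = 0) {f : MvPowerSeries σ R} {n : ℕ} (hf : (n : ℕ∞) ≤ f.order) :
    (n : ℕ∞) ≤ (subst Y f).order := by
  refine le_trans ?_ (le_order_subst hY f)
  calc (n : ℕ∞) = 1 * n := (one_mul _).symm
    _ ≤ _ := by
      gcongr
      exact le_iInf fun i => one_le_order_iff_constCoeff_eq_zero.2 (h0 i)

theorem natCast_le_order_pderiv {f : MvPowerSeries σ R} {n : ℕ} (i : σ)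
    (hf : ((n + 1 : ℕ) : ℕ∞) ≤ f.order) : (n : ℕ∞) ≤ (pderiv R i f).order := by
  refine le_order fun d hd => ?_
  rw [coeff_pderiv, coeff_of_lt_order, zero_mul]
  refine lt_of_lt_of_le ?_ hf
  rw [map_add, Finsupp.degree_single]
  exact_mod_cast Nat.succ_lt_succ (by exact_mod_cast hd)

theorem le_order_mul_right {f g : MvPowerSeries σ R} {n : ℕ∞} (hf : n ≤ f.order) :
    n ≤ (f * g).order :=
  le_trans (le_trans hf le_self_add) le_order_mul

theorem le_order_sub_truncTotal [Finite σ] (f : MvPowerSeries σ R) (n : ℕ) :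
    (n : ℕ∞) ≤ (f - (truncTotal n f : MvPolynomial σ R)).order := by
  refine le_order fun d hd => ?_
  rw [map_sub, MvPolynomial.coeff_coe, coeff_truncTotal _ (by exact_mod_cast hd), sub_self]

/-- For polynomials the chain rule follows by induction from constants, sums and multiplication by a
variable; the general case reduces to this one by truncation. -/
theorem pderiv_subst_coe [Fintype σ] {Y : σ → MvPowerSeries τ R} (p : MvPolynomial σ R) (j : τ) :
    pderiv R j (subst Y (p : MvPowerSeries σ R)) =
      ∑ i, subst Y (pderiv R i (p : MvPowerSeries σ R)) * pderiv R j (Y i) := by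
  classical
  simp only [pderiv_coe, subst_coe]
  induction p using MvPolynomial.induction_on with
  | C a => simp [MvPowerSeries.algebraMap_apply]
  | add p q hp hq => simp [hp, hq, add_mul, Finset.sum_add_distrib]
  | mul_X p k hp =>
    simp only [map_mul, MvPolynomial.aeval_X, Derivation.leibniz, hp, smul_eq_mul,
      MvPolynomial.pderiv_X, map_add, add_mul, Finset.sum_add_distrib, Finset.mul_sum]
    congr 1
    · rw [Finset.sum_eq_single k]
      · simp
      · intro b _ hb
        simp [hb.symm]
      · simp
    · exact Finset.sum_congr rfl fun i _ => by ring

/-- The chain rule. -/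
theorem pderiv_subst [Fintype σ] {Y : σ → MvPowerSeries τ R}
    (h0 : ∀ i, constantCoeff (Y i) = 0) (f : MvPowerSeries σ R) (j : τ) :
    pderiv R j (subst Y f) = ∑ i, subst Y (pderiv R i f) * pderiv R j (Y i) := by
  have hY : HasSubst Y := hasSubst_of_constantCoeff_zero h0
  ext d
  -- The part of `f` beyond the truncation must still have order above `d.degree` after a derivative
  -- has lowered it by one, so the cut is made at total degree `d.degree + 2`.
  set n := d.degree + 1
  have hg := le_order_sub_truncTotal f (n + 1)
  set p : MvPolynomial σ R := truncTotal (n + 1) f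
  set g : MvPowerSeries σ R := f - (p : MvPowerSeries σ R)
  have hf : f = p + g := by simp [g]
  have hd : (d.degree : ℕ∞) < n := by exact_mod_cast Nat.lt_succ_self _
  rw [hf, subst_add hY, map_add, pderiv_subst_coe]
  simp only [map_add, subst_add hY, add_mul, Finset.sum_add_distrib]
  rw [coeff_of_lt_order (f := pderiv R j (subst Y g)), map_sum (coeff d) (fun i => subst Y _ * _),
    map_sum (coeff d) (fun i => subst Y (pderiv R i g) * _),
    Finset.sum_eq_zero (f := fun i => coeff d (subst Y (pderiv R i g) * _))]
  · intro i _
    refine coeff_of_lt_order (lt_of_lt_of_le hd ?_)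
    exact le_order_mul_right (natCast_le_order_subst hY h0 (natCast_le_order_pderiv i hg))
  · exact lt_of_lt_of_le hd (natCast_le_order_pderiv j (natCast_le_order_subst hY h0 hg))

end Calculus

/-! ### The trace of the matrix logarithm and its derivatives. -/

section Logarithm

open MvPowerSeries

variable {σ R n : Type*} [CommRing R] [Fintype n] [DecidableEq n]

theorem natCast_le_order_matrix_pow {M : Matrix n n (MvPowerSeries σ R)}
    (hM : ∀ i j, constantCoeff (M i j) = 0) (k : ℕ) (i j : n) :
    (k : ℕ∞) ≤ ((M ^ k) i j).order := by
  induction k generalizing i j with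
  | zero => simp
  | succ k ih =>
    rw [pow_succ, Matrix.mul_apply]
    refine le_order fun d hd => ?_
    rw [map_sum]
    refine Finset.sum_eq_zero fun l _ => coeff_of_lt_order (lt_of_lt_of_le hd ?_)
    refine le_trans ?_ le_order_mul
    push_cast
    exact add_le_add (ih i l) (one_le_order_iff_constCoeff_eq_zero.2 (hM l j))

/-- The Leibniz rule gives k + 1 terms with ∂M in different positions; M and ∂M need not commute,
but cyclicity of the trace makes all the terms equal. -/
theorem trace_pderiv_pow (M : Matrix n n (MvPowerSeries σ R)) (v : σ) (k : ℕ) :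
    pderiv R v (M ^ (k + 1)).trace =
      ((k : MvPowerSeries σ R) + 1) * (M ^ k * M.map (pderiv R v)).trace := by
  have leib : ∀ A B : Matrix n n (MvPowerSeries σ R),
      (A * B).map (pderiv R v) = A.map (pderiv R v) * B + A * B.map (pderiv R v) := by
    intro A B
    ext i j : 2
    simp only [Matrix.map_apply, Matrix.mul_apply, Matrix.add_apply, map_sum, Derivation.leibniz,
      smul_eq_mul, ← Finset.sum_add_distrib]
    exact Finset.sum_congr rfl fun l _ => by rw [add_comm, mul_comm (B l j)]
  have htr : ∀ A : Matrix n n (MvPowerSeries σ R),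
      pderiv R v A.trace = (A.map (pderiv R v)).trace := by
    intro A
    simp [Matrix.trace]
  -- The extra factor `B` commuting with `M` makes the induction close: peeling off one power of `M`
  -- replaces `B` by `B * M`.
  have key : ∀ (k : ℕ) (B : Matrix n n (MvPowerSeries σ R)), B * M = M * B →
      ((M ^ (k + 1)).map (pderiv R v) * B).trace =
        ((k : MvPowerSeries σ R) + 1) * (M ^ k * B * M.map (pderiv R v)).trace := by
    intro k
    induction k with
    | zero => intro B _; simp [Matrix.trace_mul_comm B]
    | succ k ih =>
      intro B hB
      have hBM : B * M ^ (k + 1) = M ^ (k + 1) * B :=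
        (Commute.pow_right (show Commute B M from hB) _)
      have h1 : M ^ k * (B * M) = M ^ (k + 1) * B := by rw [hB, ← mul_assoc, ← pow_succ]
      have h2 : (M ^ (k + 1) * M.map (pderiv R v) * B).trace =
          (M ^ (k + 1) * B * M.map (pderiv R v)).trace := by
        rw [Matrix.trace_mul_comm, ← mul_assoc, hBM]
      rw [pow_succ M (k + 1), leib, add_mul, Matrix.trace_add, h2, mul_assoc, ← hB, ih (B * M)
        (by rw [← mul_assoc, ← hB]), h1]
      push_cast
      ring
  have := key k 1 (by simp)
  rw [mul_one, mul_one] at this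
  rw [htr, this]

variable [Algebra ℚ R]

theorem coeff_rat_smul (d : σ →₀ ℕ) (c : ℚ) (f : MvPowerSeries σ R) :
    coeff d (c • f) = c • coeff d f := rfl

/-- The entries of M^(k+1) have order at least k + 1, so powers with k ≥ N do not reach degree d.
This replaces the infinite series by a polynomial in M. -/
theorem coeff_trace_matrixLog {M : Matrix n n (MvPowerSeries σ R)}
    (hM : ∀ i j, constantCoeff (M i j) = 0) (d : σ →₀ ℕ) (N : ℕ) (hN : d.degree ≤ N) :
    coeff d (matrixLog (1 - M)).trace =
      coeff d (-∑ k ∈ Finset.range N, ((1 : ℚ) / (k + 1)) • (M ^ (k + 1)).trace) := by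
  have hterm : ∀ (i : n) (k : ℕ), ((-1 : ℚ) ^ k / ((k : ℚ) + 1)) •
      coeff d (((1 - M - 1) ^ (k + 1)) i i) =
      -(((1 : ℚ) / (k + 1)) • coeff d ((M ^ (k + 1)) i i)) := by
    intro i k
    have : (1 - M - 1) ^ (k + 1) = ((-1 : ℚ) ^ (k + 1)) • M ^ (k + 1) := by
      rw [show 1 - M - 1 = (-1 : ℚ) • M by simp, smul_pow]
    rw [this, Matrix.smul_apply, coeff_rat_smul, smul_smul, ← neg_smul]
    congr 1
    rw [div_mul_eq_mul_div, ← pow_add, show k + (k + 1) = 2 * k + 1 by ring, pow_succ, pow_mul]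
    norm_num [neg_div]
  have hfin : ∀ i : n, (∑ᶠ k : ℕ, ((-1 : ℚ) ^ k / ((k : ℚ) + 1)) •
      coeff d (((1 - M - 1) ^ (k + 1)) i i)) =
      ∑ k ∈ Finset.range N, -(((1 : ℚ) / (k + 1)) • coeff d ((M ^ (k + 1)) i i)) := by
    intro i
    simp only [hterm]
    refine finsum_eq_sum_of_support_subset _ fun k hk => ?_
    by_contra hkN
    rw [Finset.mem_coe, Finset.mem_range, not_lt] at hkN
    refine hk ?_
    simp only
    rw [coeff_of_lt_order, smul_zero, neg_zero]
    refine lt_of_lt_of_le ?_ (natCast_le_order_matrix_pow hM _ _ _)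
    exact_mod_cast Nat.lt_succ_of_le (hN.trans hkN)
  have : ∀ i : n, coeff d ((matrixLog (1 - M)) i i) = ∑ᶠ k : ℕ, ((-1 : ℚ) ^ k / ((k : ℚ) + 1)) •
      coeff d (((1 - M - 1) ^ (k + 1)) i i) := fun i => rfl
  simp only [Matrix.trace, Matrix.diag_apply, map_sum, this, hfin, map_neg, coeff_rat_smul,
    Finset.smul_sum, Finset.sum_neg_distrib]
  rw [Finset.sum_comm]

/-- The derivative of `tr ln (E - M)`, for `Q = (E - M)⁻¹`. -/
theorem pderiv_trace_matrixLog {M Q : Matrix n n (MvPowerSeries σ R)}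
    (hM : ∀ i j, constantCoeff (M i j) = 0) (hQ : Q * (1 - M) = 1) (v : σ) :
    pderiv R v (matrixLog (1 - M)).trace = -(Q * M.map (pderiv R v)).trace := by
  ext d
  -- The coefficient of the derivative at `d` comes from a coefficient of degree `d.degree + 1`, so
  -- N terms of the logarithm suffice; the same N puts the remainder `Q * M ^ N` of the geometric
  -- sum out of reach of degree `d`.
  set N := d.degree + 1
  have hgeom : ∑ k ∈ Finset.range N, M ^ k = Q - Q * M ^ N := by
    calc ∑ k ∈ Finset.range N, M ^ k = Q * ((1 - M) * ∑ k ∈ Finset.range N, M ^ k) := by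
          rw [← mul_assoc, hQ, one_mul]
      _ = _ := by rw [mul_neg_geom_sum, mul_sub, mul_one]
  have hpd : pderiv R v (-∑ k ∈ Finset.range N, ((1 : ℚ) / (k + 1)) • (M ^ (k + 1)).trace) =
      -((∑ k ∈ Finset.range N, M ^ k) * M.map (pderiv R v)).trace := by
    rw [map_neg, map_sum, Finset.sum_mul, Matrix.trace_sum]
    congr 1
    refine Finset.sum_congr rfl fun k _ => ?_
    rw [Derivation.map_smul_of_tower, trace_pderiv_pow, Algebra.smul_def, ← mul_assoc,
      show (k : MvPowerSeries σ R) + 1 = algebraMap ℚ _ ((k : ℚ) + 1) by simp, ← map_mul,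
      one_div_mul_cancel (by positivity), map_one, one_mul]
  have hsmall : coeff d (Q * M ^ N * M.map (pderiv R v)).trace = 0 := by
    rw [mul_assoc, Matrix.trace_mul_comm, Matrix.trace, map_sum]
    refine Finset.sum_eq_zero fun i _ => ?_
    rw [Matrix.diag_apply, mul_assoc, Matrix.mul_apply, map_sum]
    refine Finset.sum_eq_zero fun j _ => coeff_of_lt_order ?_
    refine lt_of_lt_of_le (b := (N : ℕ∞)) (by exact_mod_cast Nat.lt_succ_self _) ?_
    exact le_order_mul_right (natCast_le_order_matrix_pow hM _ _ _)
  rw [coeff_pderiv, coeff_trace_matrixLog hM _ N (by simp [N]), ← coeff_pderiv, hpd, hgeom,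
    sub_mul, Matrix.trace_sub, neg_sub, map_sub, hsmall, zero_sub, map_neg]

end Logarithm

end

end ColoredGraphs

namespace ColoredGraphs

noncomputable section

/-! ### The genus zero and genus one equations -/

section Equations

open MvPowerSeries

variable {r : ℕ} {R : Type*} [CommRing R]

/-- The exponent in the variables `s_{ij}` and `x_i` of a monomial in the `x_i` only. -/
def xExponent (N : Fin r →₀ ℕ) : (Sym2 (Fin r) ⊕ Fin r) →₀ ℕ := N.mapDomain Sum.inr

theorem hasSubst_atSZero :
    HasSubst (Sum.elim (fun _ => 0) MvPowerSeries.X : Sym2 (Fin r) ⊕ Fin r → XSeries r R) := by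
  apply hasSubst_of_constantCoeff_zero
  rintro (p | i) <;> simp

/-- Every monomial that contains some s_ij is sent to zero, and the pure x-monomials are sent to
themselves. -/
theorem coeff_atSZero (f : SXSeries r R) (N : Fin r →₀ ℕ) :
    coeff N (atSZero f) = coeff (xExponent N) f := by
  classical
  have hinj : Function.Injective (Sum.inr : Fin r → Sym2 (Fin r) ⊕ Fin r) := Sum.inr_injective
  have hmon : ∀ N' : Fin r →₀ ℕ, (xExponent N').prod (fun s e =>
      (Sum.elim (fun _ => 0) MvPowerSeries.X s : XSeries r R) ^ e) = monomial N' 1 := by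
    intro N'
    rw [xExponent, Finsupp.prod_mapDomain_index_inj hinj, monomial_one_eq]
    simp
  rw [atSZero, coeff_subst hasSubst_atSZero, finsum_eq_single _ (xExponent N)]
  · rw [hmon]; simp
  · intro d hd
    by_cases hs : ∃ p, d (Sum.inl p) ≠ 0
    · obtain ⟨p, hp⟩ := hs
      rw [Finsupp.prod, Finset.prod_eq_zero (Finsupp.mem_support_iff.2 hp)] <;> simp [hp]
    · push Not at hs
      have hdN : d = xExponent (d.comapDomain Sum.inr hinj.injOn) := by
        rw [xExponent]
        ext (p | i)
        · rw [hs, Finsupp.mapDomain_of_notMem_range]; simp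
        · rw [Finsupp.mapDomain_apply hinj, Finsupp.comapDomain_apply]
      rw [hdN, hmon, coeff_monomial, if_neg, smul_zero]
      intro h
      exact hd (hdN.trans (by rw [← h]))

theorem atSZero_add (f g : SXSeries r R) : atSZero (f + g) = atSZero f + atSZero g :=
  subst_add hasSubst_atSZero f g

theorem atSZero_sub (f g : SXSeries r R) : atSZero (f - g) = atSZero f - atSZero g :=
  subst_sub hasSubst_atSZero f g

theorem atSZero_mul (f g : SXSeries r R) : atSZero (f * g) = atSZero f * atSZero g :=
  subst_mul hasSubst_atSZero f g

theorem atSZero_sum {ι : Type*} (s : Finset ι) (f : ι → SXSeries r R) :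
    atSZero (∑ i ∈ s, f i) = ∑ i ∈ s, atSZero (f i) := by
  ext N
  simp [coeff_atSZero]

theorem atSZero_dx (i : Fin r) (f : SXSeries r R) : atSZero (dx i f) = dX i (atSZero f) := by
  ext N
  rw [coeff_atSZero, dx, dX, coeff_pderiv, coeff_pderiv, coeff_atSZero]
  simp [xExponent, Finsupp.mapDomain_add, Finsupp.mapDomain_single,
    Finsupp.mapDomain_apply Sum.inr_injective]

theorem atSZero_s (p : Sym2 (Fin r)) :
    atSZero (MvPowerSeries.X (Sum.inl p) : SXSeries r R) = 0 := by
  rw [atSZero, subst_X hasSubst_atSZero]; rfl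

theorem atSZero_x (i : Fin r) :
    atSZero (MvPowerSeries.X (Sum.inr i) : SXSeries r R) = MvPowerSeries.X i := by
  rw [atSZero, subst_X hasSubst_atSZero]; rfl

theorem constantCoeff_shiftedX (Phi : Fin r → SXSeries r R) (i : Fin r) :
    constantCoeff (shiftedX Phi i) = 0 := by
  simp [shiftedX, xVector, sMatrix, Matrix.mulVec, dotProduct]

theorem hasSubst_shiftedX (Phi : Fin r → SXSeries r R) : HasSubst (shiftedX Phi) :=
  hasSubst_of_constantCoeff_zero (constantCoeff_shiftedX Phi)

theorem atSZero_subst_shiftedX (Phi : Fin r → SXSeries r R) (f : XSeries r R) :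
    atSZero (subst (shiftedX Phi) f) = f := by
  rw [atSZero, subst_comp_subst_apply (hasSubst_shiftedX Phi) hasSubst_atSZero]
  have : (fun s => subst (Sum.elim (fun _ => 0) MvPowerSeries.X) (shiftedX Phi s)) =
      (MvPowerSeries.X : Fin r → XSeries r R) := by
    funext s
    change atSZero (shiftedX Phi s) = _
    simp only [shiftedX, xVector, sMatrix, Matrix.mulVec, dotProduct, Pi.add_apply, Matrix.of_apply,
      atSZero_add, atSZero_sum, atSZero_mul, atSZero_s, atSZero_x]
    simp
  rw [this, subst_self]; rfl

variable [Algebra ℚ R]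

/-- The operator `∂/∂s_{ij} - (1/{ij}!) (Φ_i ∂/∂x_j + Φ_j ∂/∂x_i)`. -/
def transport (Phi : Fin r → SXSeries r R) (i j : Fin r) (f : SXSeries r R) : SXSeries r R :=
  ds i j f - (1 / (multiFactorial (Finsupp.single i 1 + Finsupp.single j 1) : ℚ)) •
    (Phi i * dx j f + Phi j * dx i f)

/-- The operator is a first-order derivation, a combination of partial derivatives, so it inherits
the chain rule. -/
theorem transport_subst (Phi : Fin r → SXSeries r R) (i j : Fin r) {n : Type*} [Fintype n]
    {Y : n → SXSeries r R} (h0 : ∀ k, constantCoeff (Y k) = 0) (f : MvPowerSeries n R) :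
    transport Phi i j (subst Y f) =
      ∑ k, subst Y (pderiv R k f) * transport Phi i j (Y k) := by
  simp only [transport, ds, dx, pderiv_subst h0, mul_sub, Finset.sum_sub_distrib, mul_smul_comm,
    ← Finset.smul_sum, mul_add, Finset.sum_add_distrib, Finset.mul_sum]
  congr 3 <;> exact Finset.sum_congr rfl fun k _ => by rw [mul_left_comm]

theorem transport_sub (Phi : Fin r → SXSeries r R) (i j : Fin r) (f g : SXSeries r R) :
    transport Phi i j (f - g) = transport Phi i j f - transport Phi i j g := by
  simp only [transport, ds, dx, map_sub, mul_sub, smul_sub, smul_add]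
  abel

theorem transport_add (Phi : Fin r → SXSeries r R) (i j : Fin r) (f g : SXSeries r R) :
    transport Phi i j (f + g) = transport Phi i j f + transport Phi i j g := by
  simp only [transport, ds, dx, map_add, mul_add, smul_add]
  abel

theorem transport_zero (Phi : Fin r → SXSeries r R) (i j : Fin r) :
    transport Phi i j 0 = 0 := by
  simp [transport, ds, dx]

theorem transport_smul (Phi : Fin r → SXSeries r R) (i j : Fin r) (c : ℚ) (f : SXSeries r R) :
    transport Phi i j (c • f) = c • transport Phi i j f := by
  simp only [transport, ds, dx, Derivation.map_smul_of_tower, mul_smul_comm, smul_sub, smul_add]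
  rw [smul_comm c, smul_comm c]

theorem transport_sum (Phi : Fin r → SXSeries r R) (i j : Fin r) {ι : Type*} (s : Finset ι)
    (f : ι → SXSeries r R) :
    transport Phi i j (∑ k ∈ s, f k) = ∑ k ∈ s, transport Phi i j (f k) := by
  classical
  induction s using Finset.induction_on with
  | empty => simp [transport_zero]
  | insert a s ha ih => rw [Finset.sum_insert ha, Finset.sum_insert ha, transport_add, ih]

theorem transport_mul (Phi : Fin r → SXSeries r R) (i j : Fin r) (f g : SXSeries r R) :
    transport Phi i j (f * g) = transport Phi i j f * g + f * transport Phi i j g := by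
  simp only [transport, ds, dx, Derivation.leibniz, smul_eq_mul, mul_sub, sub_mul, smul_mul_assoc,
    mul_smul_comm]
  have : Phi i * (f * pderiv R (Sum.inr j) g + g * pderiv R (Sum.inr j) f) +
      Phi j * (f * pderiv R (Sum.inr i) g + g * pderiv R (Sum.inr i) f) =
      (Phi i * pderiv R (Sum.inr j) f + Phi j * pderiv R (Sum.inr i) f) * g +
      f * (Phi i * pderiv R (Sum.inr j) g + Phi j * pderiv R (Sum.inr i) g) := by ring
  rw [this, smul_add]
  ring

/-- A series is determined by its value at `S = 0` and by its images under all `transport`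
operators. -/
theorem eq_zero_of_transport_eq_zero {Phi : Fin r → SXSeries r R} {f : SXSeries r R}
    (h : ∀ i j, transport Phi i j f = 0) (h0 : atSZero f = 0) : f = 0 := by
  classical
  -- Induction on the total degree in S: the operators ∂/∂x_k and multiplication by Φ do not lower
  -- this degree, whereas ∂/∂s_ij lowers it by one, so a coefficient of S-degree n + 1 is governed
  -- by coefficients of S-degree at most n.
  let deg : ((Sym2 (Fin r) ⊕ Fin r) →₀ ℕ) → ℕ := fun d => ∑ p, d (Sum.inl p)
  have hadd : ∀ d d', deg (d + d') = deg d + deg d' := fun d d' => by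
    simp [deg, Finset.sum_add_distrib]
  have hmul : ∀ (n : ℕ) (g u : SXSeries r R), (∀ d, deg d ≤ n → coeff d u = 0) →
      ∀ d, deg d ≤ n → coeff d (g * u) = 0 := by
    intro n g u hu d hd
    rw [coeff_mul]
    refine Finset.sum_eq_zero fun x hx => ?_
    rw [Finset.HasAntidiagonal.mem_antidiagonal] at hx
    rw [hu x.2 (by rw [← hx, hadd] at hd; omega), mul_zero]
  suffices H : ∀ n d, deg d ≤ n → coeff d f = 0 by
    ext d; exact H _ d le_rfl
  intro n
  induction n with
  | zero =>
    intro d hd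
    have hz : ∀ p, d (Sum.inl p) = 0 := by
      intro p
      have := Finset.sum_eq_zero_iff.1 (Nat.le_zero.1 hd) p (Finset.mem_univ _)
      exact this
    have hdN : d = xExponent (d.comapDomain Sum.inr Sum.inr_injective.injOn) := by
      rw [xExponent]
      ext (p | i)
      · rw [hz, Finsupp.mapDomain_of_notMem_range]; simp
      · rw [Finsupp.mapDomain_apply Sum.inr_injective, Finsupp.comapDomain_apply]
    rw [hdN, ← coeff_atSZero, h0, map_zero]
  | succ n ih =>
    intro d hd
    by_cases hdn : deg d ≤ n
    · exact ih d hdn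
    obtain ⟨p, -, hp⟩ : ∃ p ∈ Finset.univ, d (Sum.inl p) ≠ 0 :=
      Finset.exists_ne_zero_of_sum_ne_zero (f := fun p => d (Sum.inl p))
        (by change deg d ≠ 0; omega)
    induction p using Sym2.inductionOn with
    | hf i j =>
      obtain ⟨d', rfl⟩ : ∃ d', d = d' + Finsupp.single (Sum.inl s(i, j)) 1 :=
        ⟨d - Finsupp.single (Sum.inl s(i, j)) 1, (tsub_add_cancel_of_le (by
          rw [Finsupp.single_le_iff]; omega)).symm⟩
      have hd' : deg d' ≤ n := by
        rw [hadd] at hd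
        have : deg (Finsupp.single (Sum.inl s(i, j)) 1) = 1 := by
          simp [deg, Finsupp.single_apply]
        omega
      have hdx : ∀ k, ∀ e, deg e ≤ n → coeff e (dx k f) = 0 := by
        intro k e he
        rw [dx, coeff_pderiv, ih, zero_mul]
        rw [hadd]
        simpa [deg, Finsupp.single_apply] using he
      have heq := congrArg (coeff d') (h i j)
      rw [transport, map_sub, coeff_rat_smul, map_add, hmul n _ _ (hdx j) _ hd',
        hmul n _ _ (hdx i) _ hd', add_zero, smul_zero, sub_zero, ds, coeff_pderiv, map_zero] at heq
      -- The derivative multiplies the coefficient by a positive integer, which is invertible over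
      -- ℚ.
      have hu : IsUnit ((d' (Sum.inl s(i, j)) : R) + 1) := by
        have : ((d' (Sum.inl s(i, j)) : R) + 1) =
            algebraMap ℚ R ((d' (Sum.inl s(i, j)) : ℚ) + 1) := by simp
        rw [this]
        exact (IsUnit.mk0 _ (by positivity)).map _
      exact hu.mul_left_eq_zero.1 heq

end Equations

end

end ColoredGraphs

namespace ColoredGraphs

noncomputable section

/-! ### Constants of transport, and the solution of the genus one equations. -/

section Equations

open MvPowerSeries

variable {r : ℕ} {R : Type*} [CommRing R]

theorem pderiv_comm {σ : Type*} (i j : σ) (f : MvPowerSeries σ R) :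
    pderiv R i (pderiv R j f) = pderiv R j (pderiv R i f) := by
  classical
  ext d
  simp only [coeff_pderiv, Finsupp.add_apply, Finsupp.single_apply]
  rw [add_right_comm]
  by_cases h : i = j
  · subst h; rfl
  · simp only [if_neg h, if_neg (Ne.symm h), add_zero]
    ring

/-- The matrix `S H(X + SΦ)`. -/
def loopMatrix (U0 : XSeries r R) (Phi : Fin r → SXSeries r R) :
    Matrix (Fin r) (Fin r) (SXSeries r R) :=
  sMatrix r R * (hessian U0).map (subst (shiftedX Phi))

theorem atSZero_loopMatrix (U0 : XSeries r R) (Phi : Fin r → SXSeries r R) (i j : Fin r) :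
    atSZero (loopMatrix U0 Phi i j) = 0 := by
  simp [loopMatrix, Matrix.mul_apply, atSZero_sum, atSZero_mul, sMatrix, atSZero_s]

theorem constantCoeff_loopMatrix (U0 : XSeries r R) (Phi : Fin r → SXSeries r R) (i j : Fin r) :
    constantCoeff (loopMatrix U0 Phi i j) = 0 := by
  simp [loopMatrix, Matrix.mul_apply, sMatrix]

variable [Algebra ℚ R]

theorem multiFactorial_single_add_single (i j : Fin r) :
    multiFactorial (Finsupp.single i 1 + Finsupp.single j 1) = if i = j then 2 else 1 := by
  classical
  rw [multiFactorial]
  split_ifs with h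
  · subst h
    rw [Finset.prod_eq_single i]
    · simp
    · intro b _ hb
      simp [Ne.symm hb]
    · simp
  · refine Finset.prod_eq_one fun b _ => ?_
    by_cases hb : i = b
    · subst hb
      simp [Ne.symm h]
    · simp only [Finsupp.add_apply, Finsupp.single_apply, if_neg hb]
      split_ifs <;> simp

/-- Contracting with the derivative `∂s_{kl}/∂s_{ij}` of the symmetric matrix of variables. -/
theorem sum_ite_sym2_mul (i j k : Fin r) (V : Fin r → SXSeries r R) :
    ∑ l, (if s(i, j) = s(k, l) then 1 else 0) * V l =
      (1 / (multiFactorial (Finsupp.single i 1 + Finsupp.single j 1) : ℚ)) •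
        ((if i = k then V j else 0) + if j = k then V i else 0) := by
  classical
  rw [multiFactorial_single_add_single]
  simp only [Sym2.eq_iff, ite_mul, one_mul, zero_mul]
  by_cases hij : i = j
  · subst hij
    by_cases hik : i = k
    · subst hik
      simp [← two_smul ℚ (V i), smul_smul]
    · simp [hik]
  · simp only [hij, if_false, Nat.cast_one, div_one, one_smul]
    by_cases hik : i = k
    · subst hik
      simp [Ne.symm hij]
    · by_cases hjk : j = k
      · subst hjk
        simp [hik]
      · simp [hik, hjk]

theorem transport_s (Phi : Fin r → SXSeries r R) (i j k l : Fin r) :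
    transport Phi i j (MvPowerSeries.X (Sum.inl s(k, l))) =
      if s(i, j) = s(k, l) then 1 else 0 := by
  classical
  simp [transport, ds, dx, pderiv_X, Pi.single_apply, eq_comm]

theorem transport_x (Phi : Fin r → SXSeries r R) (i j k : Fin r) :
    transport Phi i j (MvPowerSeries.X (Sum.inr k)) =
      -((1 / (multiFactorial (Finsupp.single i 1 + Finsupp.single j 1) : ℚ)) •
        ((if i = k then Phi j else 0) + if j = k then Phi i else 0)) := by
  classical
  simp [transport, ds, dx, pderiv_X, Pi.single_apply]
  simp only [@eq_comm _ k i, @eq_comm _ k j]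
  exact add_comm (G := SXSeries r R) _ _

/-- The genus zero equations `∂Ψ₀/∂s_{ij} = (1/{ij}!) Φ_i Φ_j`. -/
def GenusZeroEquations (Psi0 : SXSeries r R) : Prop :=
  ∀ i j : Fin r, ds i j Psi0 =
    (1 / (multiFactorial (Finsupp.single i 1 + Finsupp.single j 1) : ℚ)) •
      (gradient Psi0 i * gradient Psi0 j)

/-- Differentiate the genus zero equation for s_ij by x_k: the right side becomes Φ_i ∂_kΦ_j + Φ_j
∂_kΦ_i, and ∂_kΦ_j = ∂_jΦ_k because Φ is a gradient. -/
theorem GenusZeroEquations.transport_gradient {Psi0 : SXSeries r R}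
    (h : GenusZeroEquations Psi0) (i j k : Fin r) :
    transport (gradient Psi0) i j (gradient Psi0 k) = 0 := by
  have h1 : ds i j (gradient Psi0 k) = dx k (ds i j Psi0) := pderiv_comm _ _ _
  have h2 : ∀ l, dx l (gradient Psi0 k) = dx k (gradient Psi0 l) := fun l => pderiv_comm _ _ _
  rw [transport, h1, h i j, h2, h2]
  simp only [dx, Derivation.map_smul_of_tower, Derivation.leibniz, smul_eq_mul, sub_self]

/-- Since Φ itself is killed, only S and X contribute: (∂S/∂s_ij)Φ cancels the drift of X. -/
theorem GenusZeroEquations.transport_shiftedX {Psi0 : SXSeries r R}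
    (h : GenusZeroEquations Psi0) (i j k : Fin r) :
    transport (gradient Psi0) i j (shiftedX (gradient Psi0) k) = 0 := by
  simp only [shiftedX, xVector, sMatrix, Matrix.mulVec, dotProduct, Pi.add_apply, Matrix.of_apply,
    transport_add, transport_sum, transport_mul, h.transport_gradient, mul_zero, add_zero,
    transport_s, transport_x, sum_ite_sym2_mul, neg_add_cancel]

theorem GenusZeroEquations.transport_subst_shiftedX {Psi0 : SXSeries r R}
    (h : GenusZeroEquations Psi0) (i j : Fin r) (f : XSeries r R) :
    transport (gradient Psi0) i j (subst (shiftedX (gradient Psi0)) f) = 0 := by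
  rw [transport_subst _ _ _ (constantCoeff_shiftedX _)]
  simp [h.transport_shiftedX]

/-- Both sides are constants of transport and equal ∇U₀ at S = 0. This is the implicit equation that
determines Φ. -/
theorem GenusZeroEquations.gradient_eq {Psi0 : SXSeries r R} {U0 : XSeries r R}
    (h : GenusZeroEquations Psi0) (hU : atSZero Psi0 = U0) (k : Fin r) :
    gradient Psi0 k = subst (shiftedX (gradient Psi0)) (dX k U0) := by
  rw [← sub_eq_zero]
  refine eq_zero_of_transport_eq_zero (Phi := gradient Psi0) (fun i j => ?_) ?_
  · rw [transport_sub, h.transport_gradient, h.transport_subst_shiftedX, sub_zero]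
  · rw [atSZero_sub, atSZero_subst_shiftedX, gradient, atSZero_dx, hU, sub_self]

theorem atSZero_trace_matrixLog (U0 : XSeries r R) (Phi : Fin r → SXSeries r R) :
    atSZero (matrixLog (1 - loopMatrix U0 Phi)).trace = 0 := by
  ext N
  have hpow : ∀ (k : ℕ) (i j : Fin r), atSZero ((loopMatrix U0 Phi ^ (k + 1)) i j) = 0 := by
    intro k i j
    rw [pow_succ, Matrix.mul_apply]
    simp [atSZero_sum, atSZero_mul, atSZero_loopMatrix]
  rw [coeff_atSZero, coeff_trace_matrixLog (constantCoeff_loopMatrix U0 Phi) _ _ le_rfl, map_neg,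
    map_sum, Finset.sum_eq_zero, neg_zero, map_zero]
  intro k _
  rw [coeff_rat_smul, Matrix.trace, ← coeff_atSZero, atSZero_sum]
  simp [hpow]

/-- Write P for the Hessian of Ψ₀ and Q for the Jacobian of X + SΦ. Differentiating Φ = ∇U₀(X + SΦ)
gives P = HQ, and differentiating X + SΦ gives Q = E + SP; together (E - SH)Q = E. -/
theorem GenusZeroEquations.jacobian_mul {Psi0 : SXSeries r R} {U0 : XSeries r R}
    (h : GenusZeroEquations Psi0) (hU : atSZero Psi0 = U0) :
    Matrix.of (fun k l => dx l (gradient Psi0 k)) =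
        (hessian U0).map (subst (shiftedX (gradient Psi0))) *
          Matrix.of (fun k l => dx l (shiftedX (gradient Psi0) k)) ∧
      Matrix.of (fun k l => dx l (shiftedX (gradient Psi0) k)) *
        (1 - loopMatrix U0 (gradient Psi0)) = 1 := by
  set Q : Matrix (Fin r) (Fin r) (SXSeries r R) :=
    Matrix.of (fun k l => dx l (shiftedX (gradient Psi0) k)) with hQ
  set P : Matrix (Fin r) (Fin r) (SXSeries r R) :=
    Matrix.of (fun k l => dx l (gradient Psi0 k)) with hP
  have hPQ : P = (hessian U0).map (subst (shiftedX (gradient Psi0))) * Q := by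
    refine Matrix.ext fun k l => ?_
    rw [hP, Matrix.of_apply, h.gradient_eq hU k, dx, pderiv_subst (constantCoeff_shiftedX _),
      Matrix.mul_apply]
    refine Finset.sum_congr rfl fun m _ => ?_
    rw [hQ, Matrix.of_apply, Matrix.map_apply, hessian, Matrix.of_apply, dX, dX, pderiv_comm]
    rfl
  have hQP : Q = 1 + sMatrix r R * P := by
    classical
    refine Matrix.ext fun k l => ?_
    simp only [hQ, hP, shiftedX, xVector, sMatrix, Matrix.mulVec, dotProduct, Pi.add_apply,
      Matrix.of_apply, Matrix.add_apply, Matrix.mul_apply, dx, map_add,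
      map_sum (pderiv R (Sum.inr l)), Derivation.leibniz, smul_eq_mul]
    simp [pderiv_X, Pi.single_apply, Matrix.one_apply]
  refine ⟨hPQ, ?_⟩
  -- Over a commutative ring a one-sided inverse of a square matrix is two-sided, so it is enough to
  -- show that Q - SP = E.
  rw [mul_eq_one_comm, sub_mul, one_mul, loopMatrix, mul_assoc, ← hPQ]
  nth_rewrite 1 [hQP]
  simp

theorem GenusZeroEquations.transport_trace_matrixLog {Psi0 : SXSeries r R} {U0 : XSeries r R}
    (h : GenusZeroEquations Psi0) (hU : atSZero Psi0 = U0) (i j : Fin r) :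
    transport (gradient Psi0) i j (matrixLog (1 - loopMatrix U0 (gradient Psi0))).trace =
      -((2 / (multiFactorial (Finsupp.single i 1 + Finsupp.single j 1) : ℚ)) •
        dx i (dx j Psi0)) := by
  obtain ⟨hPQ, hQ⟩ := h.jacobian_mul hU
  set Q : Matrix (Fin r) (Fin r) (SXSeries r R) :=
    Matrix.of (fun k l => dx l (shiftedX (gradient Psi0) k))
  set M := loopMatrix U0 (gradient Psi0) with hM
  have hlog := pderiv_trace_matrixLog (constantCoeff_loopMatrix U0 (gradient Psi0)) hQ
  -- The formula for partial derivatives of tr ln is linear in the derivation, so it holds for the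
  -- transport operator too.
  have h1 : transport (gradient Psi0) i j (matrixLog (1 - M)).trace =
      -(Q * M.map (transport (gradient Psi0) i j)).trace := by
    generalize (matrixLog (1 - M)).trace = L at hlog
    simp only [transport, ds, dx, hlog, ← hM, Matrix.trace, Matrix.diag_apply, Matrix.mul_apply,
      Matrix.map_apply, mul_sub, Finset.sum_sub_distrib, mul_smul_comm, ← Finset.smul_sum, mul_add,
      Finset.sum_add_distrib, mul_neg, Finset.mul_sum, mul_left_comm (Q _ _)]
    rw [neg_sub, ← neg_add, smul_neg, sub_neg_eq_add, neg_add_eq_sub]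
  set e : Matrix (Fin r) (Fin r) (SXSeries r R) :=
    Matrix.of fun k l => if s(i, j) = s(k, l) then 1 else 0 with he
  have h2 : M.map (transport (gradient Psi0) i j) =
      e * (hessian U0).map (subst (shiftedX (gradient Psi0))) := by
    refine Matrix.ext fun k l => ?_
    simp only [hM, loopMatrix, Matrix.map_apply, Matrix.mul_apply, transport_sum, transport_mul,
      h.transport_subst_shiftedX, sMatrix, Matrix.of_apply, transport_s, mul_zero, add_zero, he]
  -- Cyclicity brings H and Q together into HQ, the Hessian of Ψ₀; its contraction with ∂S/∂s_ij
  -- picks out two entries that are equal by symmetry, hence the factor 2.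
  rw [h1, h2, ← mul_assoc, Matrix.trace_mul_comm, ← mul_assoc, ← hPQ, Matrix.trace_mul_comm]
  congr 1
  simp only [Matrix.trace, Matrix.diag_apply, Matrix.mul_apply, he, Matrix.of_apply,
    sum_ite_sym2_mul, ← Finset.smul_sum, Finset.sum_add_distrib, Finset.sum_ite_eq,
    Finset.mem_univ, if_true]
  have : dx j (gradient Psi0 i) = dx i (gradient Psi0 j) := pderiv_comm _ _ _
  rw [this, ← two_smul ℚ, smul_smul, one_div_mul_eq_div]
  rfl

/-- The genus one equations with given initial value have a unique solution, given by the one-loop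
formula. -/
theorem GenusZeroEquations.genusOne_iff {Psi0 : SXSeries r R} {U0 : XSeries r R}
    (h : GenusZeroEquations Psi0) (hU : atSZero Psi0 = U0) (U1 : XSeries r R)
    (Psi1 : SXSeries r R) :
    (GenusOneEquations Psi0 Psi1 ∧ atSZero Psi1 = U1) ↔
      Psi1 = oneLoop U0 U1 (gradient Psi0) := by
  have hone : oneLoop U0 U1 (gradient Psi0) = subst (shiftedX (gradient Psi0)) U1 -
      (1 / 2 : ℚ) • (matrixLog (1 - loopMatrix U0 (gradient Psi0))).trace := rfl
  have hiff : ∀ F : SXSeries r R, GenusOneEquations Psi0 F ↔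
      ∀ i j, transport (gradient Psi0) i j F =
        (1 / (multiFactorial (Finsupp.single i 1 + Finsupp.single j 1) : ℚ)) •
          dx i (dx j Psi0) := by
    intro F
    refine forall₂_congr fun i j => ?_
    rw [transport, sub_eq_iff_eq_add, ← smul_add, ← add_assoc]
  have hsol : ∀ i j, transport (gradient Psi0) i j (oneLoop U0 U1 (gradient Psi0)) =
      (1 / (multiFactorial (Finsupp.single i 1 + Finsupp.single j 1) : ℚ)) •
          dx i (dx j Psi0) := by
    intro i j
    rw [hone, transport_sub, transport_smul, h.transport_subst_shiftedX,
      h.transport_trace_matrixLog hU, smul_neg, zero_sub, neg_neg, smul_smul]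
    congr 1
    ring
  have hinit : atSZero (oneLoop U0 U1 (gradient Psi0)) = U1 := by
    have hz : atSZero ((1 / 2 : ℚ) • (matrixLog (1 - loopMatrix U0 (gradient Psi0))).trace) = 0 := by
      ext N
      rw [coeff_atSZero, coeff_rat_smul, ← coeff_atSZero, atSZero_trace_matrixLog, map_zero,
        smul_zero]
    rw [hone, atSZero_sub, atSZero_subst_shiftedX, hz, sub_zero]
  constructor
  · rintro ⟨h1, h2⟩
    rw [← sub_eq_zero]
    refine eq_zero_of_transport_eq_zero (Phi := gradient Psi0) (fun i j => ?_) ?_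
    · rw [transport_sub, (hiff _).1 h1, hsol, sub_self]
    · rw [atSZero_sub, h2, hinit, sub_self]
  · rintro rfl
    exact ⟨(hiff _).2 hsol, hinit⟩

end Equations

end

end ColoredGraphs

namespace ColoredGraphs

noncomputable section

/-! ### Cutting a connected configuration

A configuration attaches the half-edges `h : H` to vertices `φ h : A`; a relation `G` on the set of
half-edges says which of them are glued together. -/

section Cutting

open scoped Classical in
/-- A set of vertices that no glued pair of half-edges leaves. -/
def Saturated {H A : Type} (G : H → H → Prop) (φ : H → A) (P : Finset A) : Prop :=
  ∀ h h', G h h' → (φ h ∈ P ↔ φ h' ∈ P)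

/-- The set `B` of vertices is nonempty and is not a union of two smaller saturated sets. -/
def ConnectedOn {H A : Type} (G : H → H → Prop) (φ : H → A) (B : Finset A) : Prop :=
  B.Nonempty ∧ ∀ P ⊆ B, Saturated G φ P → P = ∅ ∨ P = B

variable {H H' A A' : Type}

/-- The relation `G` with one more glued pair. -/
def addPair (G : H → H → Prop) (p q : H) : H → H → Prop := fun h h' => G h h' ∨ (h = p ∧ h' = q)

theorem saturated_addPair {G : H → H → Prop} {p q : H} {φ : H → A} {P : Finset A} :
    Saturated (addPair G p q) φ P ↔ Saturated G φ P ∧ (φ p ∈ P ↔ φ q ∈ P) := by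
  constructor
  · exact fun h => ⟨fun x y hxy => h x y (Or.inl hxy), h p q (Or.inr ⟨rfl, rfl⟩)⟩
  · rintro ⟨h1, h2⟩ x y (hxy | ⟨rfl, rfl⟩)
    · exact h1 x y hxy
    · exact h2

theorem Saturated.compl [Fintype A] [DecidableEq A] {G : H → H → Prop} {φ : H → A} {P : Finset A}
    (hP : Saturated G φ P) : Saturated G φ Pᶜ := by
  intro x y hxy
  rw [Finset.mem_compl, Finset.mem_compl, hP x y hxy]

theorem Saturated.symmDiff [DecidableEq A] {G : H → H → Prop} {φ : H → A} {P Q : Finset A}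
    (hP : Saturated G φ P) (hQ : Saturated G φ Q) : Saturated G φ (symmDiff P Q) := by
  intro x y hxy
  rw [Finset.mem_symmDiff, Finset.mem_symmDiff, hP x y hxy, hQ x y hxy]

/-- `B` splits the configuration into two connected parts that contain `p` and `q`. -/
def Splits [Fintype A] [DecidableEq A] (G : H → H → Prop) (p q : H) (φ : H → A) (B : Finset A) :
    Prop :=
  φ p ∈ B ∧ φ q ∉ B ∧ Saturated G φ B ∧ ConnectedOn G φ B ∧ ConnectedOn G φ Bᶜ

section

variable [Fintype A] [DecidableEq A] {G : H → H → Prop} {p q : H} {φ : H → A}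

/-- The symmetric difference of the two sets is saturated and avoids both ends of the new pair, so
it stays saturated after gluing; connectedness then forces it to be empty. -/
theorem eq_of_saturated_of_connectedOn_addPair
    (hc : ConnectedOn (addPair G p q) φ Finset.univ) {P Q : Finset A}
    (hP : Saturated G φ P) (hQ : Saturated G φ Q) (hp : φ p ∈ P ↔ φ p ∈ Q) (hq : φ q ∈ P ↔ φ q ∈ Q) :
    P = Q := by
  have h1 : φ p ∉ symmDiff P Q := by rw [Finset.mem_symmDiff]; tauto
  have h2 : φ q ∉ symmDiff P Q := by rw [Finset.mem_symmDiff]; tauto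
  rcases hc.2 _ (Finset.subset_univ _)
    (saturated_addPair.2 ⟨hP.symmDiff hQ, iff_of_false h1 h2⟩) with h | h
  · exact symmDiff_eq_bot.1 h
  · exact absurd (h ▸ Finset.mem_univ _) h1

theorem ConnectedOn.addPair_of_univ (hc : ConnectedOn G φ Finset.univ) :
    ConnectedOn (addPair G p q) φ Finset.univ :=
  ⟨hc.1, fun P hP hs => hc.2 P hP (saturated_addPair.1 hs).1⟩

theorem Splits.not_connectedOn {B : Finset A} (hB : Splits G p q φ B) :
    ¬ ConnectedOn G φ Finset.univ := by
  intro hc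
  rcases hc.2 B (Finset.subset_univ _) hB.2.2.1 with h | h
  · exact Finset.notMem_empty _ (h ▸ hB.1)
  · exact hB.2.1 (h ▸ Finset.mem_univ _)

/-- A saturated set meets each of the two connected parts in nothing or everything, and the new pair
forces the same alternative in both. -/
theorem Splits.connectedOn_addPair {B : Finset A} (hB : Splits G p q φ B) :
    ConnectedOn (addPair G p q) φ Finset.univ := by
  obtain ⟨hp, hq, hs, h1, h2⟩ := hB
  refine ⟨⟨φ p, Finset.mem_univ _⟩, fun P _ hP => ?_⟩
  obtain ⟨hP, hpq⟩ := saturated_addPair.1 hP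
  have inter : ∀ Q : Finset A, Saturated G φ Q → Saturated G φ (P ∩ Q) := by
    intro Q hQ x y hxy
    rw [Finset.mem_inter, Finset.mem_inter, hP x y hxy, hQ x y hxy]
  have hqc : φ q ∈ Bᶜ := Finset.mem_compl.2 hq
  have hPB : P = (P ∩ B) ∪ (P ∩ Bᶜ) := by
    rw [← Finset.inter_union_distrib_left, Finset.union_compl, Finset.inter_univ]
  by_cases h : φ p ∈ P
  · right
    rcases h1.2 _ Finset.inter_subset_right (inter B hs) with e1 | e1
    · exact absurd (e1 ▸ Finset.mem_inter.2 ⟨h, hp⟩) (Finset.notMem_empty _)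
    rcases h2.2 _ Finset.inter_subset_right (inter _ hs.compl) with e2 | e2
    · exact absurd (e2 ▸ Finset.mem_inter.2 ⟨hpq.1 h, hqc⟩) (Finset.notMem_empty _)
    rw [hPB, e1, e2, Finset.union_compl]
  · left
    have h' : φ q ∉ P := fun h' => h (hpq.2 h')
    rcases h1.2 _ Finset.inter_subset_right (inter B hs) with e1 | e1
    · rcases h2.2 _ Finset.inter_subset_right (inter _ hs.compl) with e2 | e2
      · rw [hPB, e1, e2, Finset.union_empty]
      · exact absurd (Finset.mem_inter.1 (e2.symm ▸ hqc)).1 h'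
    · exact absurd (Finset.mem_inter.1 (e1.symm ▸ hp)).1 h

/-- A proper nonempty saturated set must separate the ends of the new pair, since otherwise it would
survive the gluing. Connectedness of either part follows by comparing its saturated subsets with
that part and with the empty set, using that a saturated set is determined by which ends it
contains. -/
theorem exists_splits (hc : ConnectedOn (addPair G p q) φ Finset.univ)
    (hn : ¬ ConnectedOn G φ Finset.univ) : ∃ B, Splits G p q φ B := by
  have key : ∃ B, Saturated G φ B ∧ φ p ∈ B ∧ φ q ∉ B := by
    rw [ConnectedOn] at hn
    push Not at hn
    obtain ⟨P, -, hP, hne, hnu⟩ := hn hc.1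
    have hpq : ¬ (φ p ∈ P ↔ φ q ∈ P) := by
      intro hpq
      rcases hc.2 P (Finset.subset_univ _) (saturated_addPair.2 ⟨hP, hpq⟩) with h | h
      · exact hne.ne_empty h
      · exact hnu h
    by_cases h : φ p ∈ P
    · exact ⟨P, hP, h, by tauto⟩
    · refine ⟨Pᶜ, hP.compl, ?_, ?_⟩ <;> rw [Finset.mem_compl] <;> tauto
  obtain ⟨B, hB, hp, hq⟩ := key
  have hempty : Saturated G φ ∅ := fun _ _ _ => by simp
  refine ⟨B, hp, hq, hB, ⟨⟨_, hp⟩, fun P hPB hP => ?_⟩, ⟨⟨φ q, by simpa⟩, fun P hPB hP => ?_⟩⟩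
  · have hqP : φ q ∉ P := fun h => hq (hPB h)
    by_cases h : φ p ∈ P
    · right
      exact eq_of_saturated_of_connectedOn_addPair hc hP hB (by tauto) (by tauto)
    · left
      exact eq_of_saturated_of_connectedOn_addPair hc hP hempty (by simp [h]) (by simp [hqP])
  · have hpP : φ p ∉ P := fun h => Finset.mem_compl.1 (hPB h) hp
    by_cases h : φ q ∈ P
    · right
      exact eq_of_saturated_of_connectedOn_addPair hc hP hB.compl (by simp [hp, hpP])
        (by simp [hq, h])
    · left
      exact eq_of_saturated_of_connectedOn_addPair hc hP hempty (by simp [hpP]) (by simp [h])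

open scoped Classical in
/-- A configuration that is connected after gluing `p` and `q` either is connected already, or
falls into two connected parts in exactly one way. -/
theorem ite_connectedOn_addPair {B : Type*} [CommRing B] (G : H → H → Prop) (p q : H) (φ : H → A) :
    (if ConnectedOn (addPair G p q) φ Finset.univ then (1 : B) else 0) =
      (if ConnectedOn G φ Finset.univ then 1 else 0) +
        ∑ P : Finset A, if Splits G p q φ P then 1 else 0 := by
  by_cases hc : ConnectedOn G φ Finset.univ
  · rw [if_pos hc.addPair_of_univ, if_pos hc, Finset.sum_eq_zero, add_zero]
    exact fun P _ => if_neg fun h => h.not_connectedOn hc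
  rw [if_neg hc, zero_add]
  by_cases hc' : ConnectedOn (addPair G p q) φ Finset.univ
  · obtain ⟨P, hP⟩ := exists_splits hc' hc
    rw [if_pos hc', Finset.sum_eq_single P, if_pos hP]
    · intro Q _ hQP
      refine if_neg fun hQ => hQP ?_
      exact eq_of_saturated_of_connectedOn_addPair hc' hQ.2.2.1 hP.2.2.1
        (iff_of_true hQ.1 hP.1) (iff_of_false hQ.2.1 hP.2.1)
    · simp
  · rw [if_neg hc', Finset.sum_eq_zero]
    exact fun P _ => if_neg fun h => hc' h.connectedOn_addPair

end

/-- Connectedness of a part of a configuration, in terms of the restricted configuration. -/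
theorem connectedOn_map_iff [Fintype A'] {G : H → H → Prop} {φ : H → A} {φ' : H' → A'} (i : H' → H)
    (j : A' ↪ A) (hφ : ∀ h, φ (i h) = j (φ' h)) (hi : ∀ h v, φ h = j v → ∃ h', i h' = h)
    (hs : Saturated G φ (Finset.univ.map j)) :
    ConnectedOn G φ (Finset.univ.map j) ↔
      ConnectedOn (fun x y => G (i x) (i y)) φ' Finset.univ := by
  classical
  rw [ConnectedOn, ConnectedOn, Finset.map_nonempty]
  refine and_congr_right fun _ => ⟨fun h P' _ hP' => ?_, fun h P hPB hP => ?_⟩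
  · have : Saturated G φ (P'.map j) := by
      have aux : ∀ x y, (G x y ∨ G y x) → φ x ∈ P'.map j → φ y ∈ P'.map j := by
        intro x y hxy hx
        obtain ⟨v, hv, hvx⟩ := Finset.mem_map.1 hx
        obtain ⟨x', rfl⟩ := hi x v hvx.symm
        have hy : φ y ∈ Finset.univ.map j := by
          have hx' : φ (i x') ∈ Finset.univ.map j := by simp [hφ]
          rcases hxy with hxy | hxy
          · exact (hs _ _ hxy).1 hx'
          · exact (hs _ _ hxy).2 hx'
        obtain ⟨w, -, hwy⟩ := Finset.mem_map.1 hy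
        obtain ⟨y', rfl⟩ := hi y w hwy.symm
        rw [hφ, Finset.mem_map' j] at hx ⊢
        rcases hxy with hxy | hxy
        · exact (hP' _ _ hxy).1 hx
        · exact (hP' _ _ hxy).2 hx
      exact fun x y hxy => ⟨aux x y (Or.inl hxy), aux y x (Or.inr hxy)⟩
    rcases h _ (Finset.map_subset_map.2 (Finset.subset_univ _)) this with e | e
    · exact Or.inl (Finset.map_eq_empty.1 e)
    · exact Or.inr (Finset.map_injective j e)
  · obtain ⟨P', -, rfl⟩ := Finset.subset_map_iff.1 hPB
    have : Saturated (fun x y => G (i x) (i y)) φ' P' := by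
      intro x y hxy
      have := hP _ _ hxy
      rwa [hφ, hφ, Finset.mem_map' j, Finset.mem_map' j] at this
    rcases h P' (Finset.subset_univ _) this with rfl | rfl
    · exact Or.inl rfl
    · exact Or.inr rfl

end Cutting

end

end ColoredGraphs

namespace ColoredGraphs

noncomputable section

/-! ### Weighted sums over configurations, and how they factor along a splitting. -/

section ConfigurationSums

open scoped Classical

variable {r : ℕ} {B : Type*} [CommRing B] {H H' A A' : Type}
  [Fintype H] [Fintype H'] [Fintype A] [Fintype A']

/-- The numbers of half-edges of each color at a vertex. -/
def confValence (k : H → Fin r) (φ : H → A) (v : A) : Fin r →₀ ℕ :=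
  ∑ h, if φ h = v then Finsupp.single (k h) 1 else 0

/-- The product of the weights of all vertices of a configuration. -/
def confWeight (α : (Fin r →₀ ℕ) → B) (k : H → Fin r) (φ : H → A) : B :=
  ∏ v, α (confValence k φ v)

/-- The sum of the weights of all connected configurations. -/
def confSum (α : (Fin r →₀ ℕ) → B) (k : H → Fin r) (G : H → H → Prop) (A : Type) [Fintype A] : B :=
  ∑ φ : H → A, if ConnectedOn G φ Finset.univ then confWeight α k φ else 0

theorem confValence_eq [DecidableEq A] (k : H → Fin r) (φ : H → A) (v : A) :
    confValence k φ v = ∑ h, if φ h = v then Finsupp.single (k h) 1 else 0 :=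
  Finset.sum_congr rfl fun _ _ => by congr

theorem confSum_eq [Fintype (H → A)] (α : (Fin r →₀ ℕ) → B) (k : H → Fin r) (G : H → H → Prop)
    [∀ φ : H → A, Decidable (ConnectedOn G φ Finset.univ)] :
    confSum α k G A =
      ∑ φ : H → A, if ConnectedOn G φ Finset.univ then confWeight α k φ else 0 :=
  Finset.sum_congr (by ext; simp) fun _ _ => by congr

theorem confSum_congr (α : (Fin r →₀ ℕ) → B) {k : H → Fin r} {k' : H' → Fin r}
    {G : H → H → Prop} {G' : H' → H' → Prop} (e : H ≃ H') (f : A ≃ A')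
    (hk : ∀ h, k' (e h) = k h) (hG : ∀ x y, G' (e x) (e y) ↔ G x y) :
    confSum α k G A = confSum α k' G' A' := by
  rw [confSum, confSum]
  refine Fintype.sum_equiv (e.arrowCongr f) _ _ fun φ => ?_
  have hφ : ∀ h, (e.arrowCongr f φ) (e h) = f (φ h) := fun h => by simp
  have h1 : ConnectedOn G φ Finset.univ ↔ ConnectedOn G' (e.arrowCongr f φ) Finset.univ := by
    have h2 := connectedOn_map_iff (G := G') (φ := e.arrowCongr f φ) (φ' := φ) e f.toEmbedding hφ
      (fun h v _ => e.surjective h) (fun _ _ _ => by simp)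
    rw [Finset.map_univ_equiv] at h2
    rw [h2]
    simp only [hG]
  have h2 : confWeight α k φ = confWeight α k' (e.arrowCongr f φ) := by
    refine Fintype.prod_equiv f _ _ fun v => congrArg α ?_
    refine Fintype.sum_equiv e _ _ fun h => ?_
    rw [hφ, hk, f.apply_eq_iff_eq]
  rw [h2]
  exact if_congr h1 rfl rfl

theorem confSum_eq_confSum_fin (α : (Fin r →₀ ℕ) → B) (k : H → Fin r) (G : H → H → Prop) :
    confSum α k G A = confSum α k G (Fin (Fintype.card A)) :=
  confSum_congr α (Equiv.refl H) (Fintype.equivFin A) (fun _ => rfl) fun _ _ => Iff.rfl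

variable [DecidableEq H] [DecidableEq A]

/-- Configurations that map `X` to `Y` and the complement of `X` to the complement of `Y`. -/
def splitEquiv (X : Finset H) (Y : Finset A) :
    {φ : H → A // ∀ h, φ h ∈ Y ↔ h ∈ X} ≃
      ({h // h ∈ X} → {v // v ∈ Y}) × ({h // h ∉ X} → {v // v ∉ Y}) where
  toFun φ := (fun h => ⟨φ.1 h, (φ.2 h).2 h.2⟩, fun h => ⟨φ.1 h, fun hh => h.2 ((φ.2 h).1 hh)⟩)
  invFun ψ := ⟨fun h => if hh : h ∈ X then (ψ.1 ⟨h, hh⟩).1 else (ψ.2 ⟨h, hh⟩).1, fun h => by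
    by_cases hh : h ∈ X
    · simp [hh]
    · simpa [hh] using (ψ.2 ⟨h, hh⟩).2⟩
  left_inv φ := by
    ext h
    by_cases hh : h ∈ X <;> simp [hh]
  right_inv ψ := by
    refine Prod.ext (funext fun h => ?_) (funext fun h => ?_)
    · simp
    · exact Subtype.ext (dif_neg h.2)

/-- A vertex in Y meets only half-edges in X and a vertex outside Y only half-edges outside X, so
the valences, and with them the product of weights, separate. -/
theorem confWeight_split (α : (Fin r →₀ ℕ) → B) (k : H → Fin r) {X : Finset H} {Y : Finset A}
    (φ : {φ : H → A // ∀ h, φ h ∈ Y ↔ h ∈ X}) :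
    confWeight α k φ.1 =
      confWeight α (fun h : {h // h ∈ X} => k h) (splitEquiv X Y φ).1 *
        confWeight α (fun h : {h // h ∉ X} => k h) (splitEquiv X Y φ).2 := by
  rw [confWeight, ← Fintype.prod_subtype_mul_prod_subtype (· ∈ Y)]
  congr 1
  · refine Finset.prod_congr (by ext; simp) fun v _ => congrArg α ?_
    rw [confValence, ← Fintype.sum_subtype_add_sum_subtype (· ∈ X)]
    convert add_zero _
    · refine Finset.sum_eq_zero fun h _ => if_neg fun hh => h.2 ?_
      rw [← φ.2, hh]
      exact v.2
    · rw [confValence_eq]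
      exact Finset.sum_congr (by ext; simp) fun h _ => by simp [splitEquiv, ← Subtype.coe_inj]
  · refine Finset.prod_congr rfl fun v _ => congrArg α ?_
    rw [confValence, ← Fintype.sum_subtype_add_sum_subtype (· ∈ X)]
    convert zero_add _
    · refine Finset.sum_eq_zero fun h _ => if_neg fun hh => v.2 ?_
      rw [← hh, φ.2]
      exact h.2
    · rw [confValence_eq]
      exact Finset.sum_congr rfl fun h _ => by simp [splitEquiv, ← Subtype.coe_inj]

theorem splits_iff {G : H → H → Prop} {p q : H} {X : Finset H} {Y : Finset A}
    (φ : {φ : H → A // ∀ h, φ h ∈ Y ↔ h ∈ X}) :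
    Splits G p q φ.1 Y ↔ (p ∈ X ∧ q ∉ X ∧ ∀ x y, G x y → (x ∈ X ↔ y ∈ X)) ∧
      ConnectedOn (fun x y : {h // h ∈ X} => G x y) (splitEquiv X Y φ).1 Finset.univ ∧
      ConnectedOn (fun x y : {h // h ∉ X} => G x y) (splitEquiv X Y φ).2 Finset.univ := by
  have hs : Saturated G φ.1 Y ↔ ∀ x y, G x y → (x ∈ X ↔ y ∈ X) := by
    simp only [Saturated, φ.2]
  rw [Splits, φ.2, φ.2, hs, and_assoc, and_assoc]
  refine and_congr_right fun _ => and_congr_right fun _ => and_congr_right fun hX => ?_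
  rw [← hs] at hX
  have e1 : (Finset.univ : Finset {v // v ∈ Y}).map (Function.Embedding.subtype _) = Y := by
    ext v; simp
  have e2 : (Finset.univ : Finset {v // v ∉ Y}).map (Function.Embedding.subtype _) = Yᶜ := by
    ext v; simp
  have h1 := connectedOn_map_iff (G := G) (φ := φ.1) (φ' := (splitEquiv X Y φ).1) Subtype.val
    (Function.Embedding.subtype _) (fun h => rfl)
    (fun h v hv => ⟨⟨h, by rw [← φ.2, hv]; exact v.2⟩, rfl⟩) (by rwa [e1])
  have h2 := connectedOn_map_iff (G := G) (φ := φ.1) (φ' := (splitEquiv X Y φ).2) Subtype.val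
    (Function.Embedding.subtype _) (fun h => rfl)
    (fun h v hv => ⟨⟨h, by rw [← φ.2, hv]; exact v.2⟩, rfl⟩) (by rw [e2]; exact hX.compl)
  rw [e1] at h1
  rw [e2] at h2
  rw [h1, h2]

theorem sum_splits_confWeight (α : (Fin r →₀ ℕ) → B) (k : H → Fin r) (G : H → H → Prop) (p q : H)
    (X : Finset H) (Y : Finset A) :
    (∑ φ : {φ : H → A // ∀ h, φ h ∈ Y ↔ h ∈ X}, if Splits G p q φ.1 Y then confWeight α k φ.1
        else 0) =
      if p ∈ X ∧ q ∉ X ∧ ∀ x y, G x y → (x ∈ X ↔ y ∈ X) then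
        confSum α (fun h : {h // h ∈ X} => k h) (fun x y => G x y) {v // v ∈ Y} *
          confSum α (fun h : {h // h ∉ X} => k h) (fun x y => G x y) {v // v ∉ Y} else 0 := by
  simp only [splits_iff]
  split_ifs with hX
  · simp only [eq_true hX, true_and]
    rw [confSum_eq, confSum_eq, Finset.sum_mul_sum, ← Finset.sum_product',
      Finset.univ_product_univ]
    refine Fintype.sum_equiv (splitEquiv X Y) _ _ fun φ => ?_
    rw [confWeight_split, ite_zero_mul_ite_zero]
  · simp [hX]

/-- Removing a glued pair of half-edges from all connected configurations. -/
theorem confSum_addPair (α : (Fin r →₀ ℕ) → B) (k : H → Fin r) (G : H → H → Prop) (p q : H) :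
    confSum α k (addPair G p q) A = confSum α k G A +
      ∑ X : Finset H, if p ∈ X ∧ q ∉ X ∧ ∀ x y, G x y → (x ∈ X ↔ y ∈ X) then
        ∑ Y : Finset A,
          confSum α (fun h : {h // h ∈ X} => k h) (fun x y => G x y) {v // v ∈ Y} *
            confSum α (fun h : {h // h ∉ X} => k h) (fun x y => G x y) {v // v ∉ Y} else 0 := by
  have h1 : ∀ φ : H → A,
      (if ConnectedOn (addPair G p q) φ Finset.univ then confWeight α k φ else 0) =
      (if ConnectedOn G φ Finset.univ then confWeight α k φ else 0) +
        ∑ Y : Finset A, if Splits G p q φ Y then confWeight α k φ else 0 := by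
    intro φ
    have := congrArg (· * confWeight α k φ) (ite_connectedOn_addPair (B := B) G p q φ)
    simpa only [add_mul, ite_mul, one_mul, zero_mul, Finset.sum_mul] using this
  rw [confSum_eq, Finset.sum_congr rfl fun φ _ => h1 φ, Finset.sum_add_distrib]
  rw [← confSum_eq]
  congr 1
  rw [Finset.sum_comm]
  -- The configurations are sorted by the preimage X of Y; for fixed X and Y they are pairs of
  -- independent configurations on the two parts.
  have h2 : ∀ Y : Finset A, (∑ φ : H → A, if Splits G p q φ Y then confWeight α k φ else 0) =
      ∑ X : Finset H, ∑ φ : {φ : H → A // ∀ h, φ h ∈ Y ↔ h ∈ X},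
        if Splits G p q φ.1 Y then confWeight α k φ.1 else 0 := by
    intro Y
    rw [← Finset.sum_fiberwise (g := fun φ : H → A => Finset.univ.filter fun h => φ h ∈ Y)]
    refine Finset.sum_congr rfl fun X _ => ?_
    refine Finset.sum_subtype _ (fun φ => ?_) _
    simp [Finset.ext_iff]
  simp only [h2, sum_splits_confWeight]
  rw [Finset.sum_comm]
  refine Finset.sum_congr rfl fun X _ => ?_
  split_ifs <;> simp

end ConfigurationSums

end

end ColoredGraphs

namespace ColoredGraphs

noncomputable section

/-! ### Graphs with labelled `s`-vertices and tails -/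

section Labelled

open scoped Classical

/-- The choices of an order of the two colors at each `s`-vertex. -/
abbrev Lift {r : ℕ} {S : Type} (cs : S → Sym2 (Fin r)) : Type :=
  ∀ s, {p : Fin r × Fin r // s(p.1, p.2) = cs s}

/-- The half-edges at `a`-vertices: two for each `s`-vertex and one for each tail. -/
abbrev HalfEdge (S T : Type) : Type := S × Bool ⊕ T

/-- The half-edges belonging to the same `s`-vertex are glued. -/
def glue (S T : Type) : HalfEdge S T → HalfEdge S T → Prop :=
  fun x y => ∃ s, x = Sum.inl (s, false) ∧ y = Sum.inl (s, true)

variable {r : ℕ} {S T A : Type}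

/-- The coloring of the half-edges. -/
def halfColor {cs : S → Sym2 (Fin r)} (o : Lift cs) (ct : T → Fin r) : HalfEdge S T → Fin r :=
  Sum.elim (fun x => bif x.2 then (o x.1).1.2 else (o x.1).1.1) ct

/-- Regard each `s`-vertex as one edge between `a`-vertices: a connected graph has at most one
vertex more than edges. This bounds the number of `a`-vertices and makes the subtraction in the loop
number `|S| + 1 - |A|` exact. -/
theorem card_le_of_connectedOn_glue [Fintype S] [Fintype A] {φ : HalfEdge S T → A}
    (h : ConnectedOn (glue S T) φ Finset.univ) : Fintype.card A ≤ Fintype.card S + 1 := by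
  let Γ : SimpleGraph A := SimpleGraph.fromRel fun v w =>
    ∃ s, v = φ (Sum.inl (s, false)) ∧ w = φ (Sum.inl (s, true))
  obtain ⟨v, -⟩ := h.1
  have hreach : ∀ w, Γ.Reachable v w := by
    have hsat : Saturated (glue S T) φ (Finset.univ.filter fun w => Γ.Reachable v w) := by
      rintro _ _ ⟨s, rfl, rfl⟩
      have : Γ.Reachable (φ (Sum.inl (s, false))) (φ (Sum.inl (s, true))) := by
        by_cases he : φ (Sum.inl (s, false)) = φ (Sum.inl (s, true))
        · rw [he]
        · exact SimpleGraph.Adj.reachable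
            ((SimpleGraph.fromRel_adj _ _ _).2 ⟨he, Or.inl ⟨s, rfl, rfl⟩⟩)
      simp only [Finset.mem_filter, Finset.mem_univ, true_and]
      exact ⟨fun hr => hr.trans this, fun hr => hr.trans this.symm⟩
    rcases h.2 _ (Finset.subset_univ _) hsat with he | he
    · exact absurd (he ▸ Finset.mem_filter.2 ⟨Finset.mem_univ v, SimpleGraph.Reachable.refl v⟩)
        (Finset.notMem_empty v)
    · intro w
      exact (Finset.mem_filter.1 (he.symm ▸ Finset.mem_univ w)).2
  have hconn : Γ.Connected :=
    { preconnected := fun w w' => (hreach w).symm.trans (hreach w'), nonempty := ⟨v⟩ }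
  have h1 := hconn.card_vert_le_card_edgeSet_add_one
  have h2 : Nat.card Γ.edgeSet ≤ Nat.card S := by
    have hsub : Γ.edgeSet ⊆
        Set.range fun s : S => s(φ (Sum.inl (s, false)), φ (Sum.inl (s, true))) := by
      intro e
      induction e using Sym2.inductionOn with
      | hf x y =>
        intro hxy
        rcases ((SimpleGraph.fromRel_adj _ _ _).1 (Γ.mem_edgeSet.1 hxy)).2 with ⟨s, rfl, rfl⟩ | ⟨s, rfl, rfl⟩
        · exact ⟨s, rfl⟩
        · exact ⟨s, Sym2.eq_swap⟩
    exact (Nat.card_mono (Set.finite_range _) hsub).trans (Finite.card_range_le _)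
  rw [Nat.card_eq_fintype_card (α := A)] at h1
  rw [Nat.card_eq_fintype_card (α := S)] at h2
  omega

variable {B : Type*} [CommRing B] [Fintype S] [Fintype T] [Fintype A]

/-- The sum of the weights of all connected graphs with given `a`-vertices and with `s`-vertices and
tails of given colors. -/
def labelledSum (α : (Fin r →₀ ℕ) → B) (cs : S → Sym2 (Fin r)) (ct : T → Fin r) (A : Type)
    [Fintype A] : B :=
  ∑ o : Lift cs, confSum α (halfColor o ct) (glue S T) A

theorem labelledSum_eq (α : (Fin r →₀ ℕ) → B) (cs : S → Sym2 (Fin r)) (ct : T → Fin r)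
    [Fintype (Lift cs)] :
    labelledSum α cs ct A = ∑ o : Lift cs, confSum α (halfColor o ct) (glue S T) A :=
  Finset.sum_congr (by ext; simp) fun _ _ => rfl

theorem labelledSum_eq_zero (α : (Fin r →₀ ℕ) → B) (cs : S → Sym2 (Fin r)) (ct : T → Fin r)
    (h : Fintype.card S + 1 < Fintype.card A) : labelledSum α cs ct A = 0 := by
  refine Finset.sum_eq_zero fun o _ => Finset.sum_eq_zero fun φ _ => if_neg fun hφ => ?_
  have := card_le_of_connectedOn_glue hφ
  omega

theorem labelledSum_eq_labelledSum_fin (α : (Fin r →₀ ℕ) → B) (cs : S → Sym2 (Fin r))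
    (ct : T → Fin r) : labelledSum α cs ct A = labelledSum α cs ct (Fin (Fintype.card A)) :=
  Finset.sum_congr rfl fun _ _ => confSum_eq_confSum_fin _ _ _

/-- Cutting an `s`-vertex turns its two half-edges into tails. -/
def cutEquiv (S T : Type) : HalfEdge (Option S) T ≃ HalfEdge S (Option (Option T)) where
  toFun := Sum.elim
    (fun x => x.1.elim (bif x.2 then Sum.inr (some none) else Sum.inr none) fun s =>
      Sum.inl (s, x.2))
    fun t => Sum.inr (some (some t))
  invFun := Sum.elim (fun x => Sum.inl (some x.1, x.2)) fun t =>
    t.elim (Sum.inl (none, false)) fun t' => t'.elim (Sum.inl (none, true)) Sum.inr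
  left_inv := by rintro (⟨_ | s, _ | _⟩ | t) <;> rfl
  right_inv := by rintro (⟨s, b⟩ | (_ | _ | t)) <;> rfl

/-- Splitting off the order of the colors at one `s`-vertex. -/
def liftOptionEquiv (p : Sym2 (Fin r)) (cs : S → Sym2 (Fin r)) :
    Lift (fun x : Option S => x.elim p cs) ≃
      {ij : Fin r × Fin r // s(ij.1, ij.2) = p} × Lift cs :=
  Equiv.piOptionEquivProd

/-- Cutting the `s`-vertex `none` only renames its half-edges as two additional tails, with the
gluing between them kept as an added pair, so the general cutting identity applies. -/
theorem confSum_option (α : (Fin r →₀ ℕ) → B) {p : Sym2 (Fin r)} {cs : S → Sym2 (Fin r)}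
    (o : {ij : Fin r × Fin r // s(ij.1, ij.2) = p} × Lift cs) (ct : T → Fin r) :
    confSum α (halfColor ((liftOptionEquiv p cs).symm o) ct) (glue (Option S) T) A =
      confSum α (halfColor o.2
          fun x : Option (Option T) => x.elim o.1.1.1 fun y => y.elim o.1.1.2 ct)
        (addPair (glue S (Option (Option T))) (Sum.inr none) (Sum.inr (some none))) A := by
  refine confSum_congr α (cutEquiv S T) (Equiv.refl A) ?_ ?_
  · rintro (⟨_ | s, _ | _⟩ | t) <;> rfl
  · have h1 : ∀ s b, cutEquiv S T (Sum.inl (some s, b)) = Sum.inl (s, b) := fun _ _ => rfl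
    have h2 : cutEquiv S T (Sum.inl (none, false)) = Sum.inr none := rfl
    have h3 : cutEquiv S T (Sum.inl (none, true)) = Sum.inr (some none) := rfl
    intro x y
    constructor
    · rintro (⟨s, hx, hy⟩ | ⟨hx, hy⟩)
      · rw [← h1, Equiv.apply_eq_iff_eq] at hx hy
        exact ⟨some s, hx, hy⟩
      · rw [← h2, Equiv.apply_eq_iff_eq] at hx
        rw [← h3, Equiv.apply_eq_iff_eq] at hy
        exact ⟨none, hx, hy⟩
    · rintro ⟨_ | s, rfl, rfl⟩
      · exact Or.inr ⟨h2, h3⟩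
      · exact Or.inl ⟨s, rfl, rfl⟩

/-- The half-edges of the part with `s`-vertices `X`, tails `Y` and the first of the two additional
tails. -/
def partHalfEdges (X : Finset S) (Y : Finset T) : Finset (HalfEdge S (Option (Option T))) :=
  Finset.univ.filter fun h =>
    Sum.elim (fun x => x.1 ∈ X) (fun t => t.elim True fun t' => t'.elim False (· ∈ Y)) h

section

variable (X : Finset S) (Y : Finset T)

theorem inl_mem_partHalfEdges (x : S × Bool) : Sum.inl x ∈ partHalfEdges X Y ↔ x.1 ∈ X := by
  simp [partHalfEdges]

theorem none_mem_partHalfEdges : Sum.inr none ∈ partHalfEdges X Y := by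
  simp [partHalfEdges]

theorem some_none_notMem_partHalfEdges : Sum.inr (some none) ∉ partHalfEdges X Y := by
  simp [partHalfEdges]

theorem some_some_mem_partHalfEdges (t : T) :
    Sum.inr (some (some t)) ∈ partHalfEdges X Y ↔ t ∈ Y := by
  simp [partHalfEdges]

/-- The half-edges of the first part. -/
def partEquiv : HalfEdge {s // s ∈ X} (Option {t // t ∈ Y}) ≃ {h // h ∈ partHalfEdges X Y} :=
  Equiv.ofBijective
    (Sum.elim
      (fun x => ⟨Sum.inl (x.1.1, x.2), (inl_mem_partHalfEdges X Y _).2 x.1.2⟩)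
      fun t => t.elim ⟨Sum.inr none, none_mem_partHalfEdges X Y⟩ fun t' =>
        ⟨Sum.inr (some (some t'.1)), (some_some_mem_partHalfEdges X Y _).2 t'.2⟩) (by
    constructor
    · rintro (⟨⟨s, hs⟩, b⟩ | (_ | ⟨t, ht⟩)) (⟨⟨s', hs'⟩, b'⟩ | (_ | ⟨t', ht'⟩)) <;> simp
    · rintro ⟨⟨s, b⟩ | (_ | (_ | t)), h⟩
      · exact ⟨Sum.inl (⟨s, (inl_mem_partHalfEdges X Y _).1 h⟩, b), rfl⟩
      · exact ⟨Sum.inr none, rfl⟩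
      · exact absurd h (some_none_notMem_partHalfEdges X Y)
      · exact ⟨Sum.inr (some ⟨t, (some_some_mem_partHalfEdges X Y _).1 h⟩), rfl⟩)

/-- The half-edges of the second part. -/
def partComplEquiv :
    HalfEdge {s // s ∉ X} (Option {t // t ∉ Y}) ≃ {h // h ∉ partHalfEdges X Y} :=
  Equiv.ofBijective
    (Sum.elim
      (fun x => ⟨Sum.inl (x.1.1, x.2), fun h => x.1.2 ((inl_mem_partHalfEdges X Y _).1 h)⟩)
      fun t => t.elim ⟨Sum.inr (some none), some_none_notMem_partHalfEdges X Y⟩ fun t' =>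
        ⟨Sum.inr (some (some t'.1)), fun h => t'.2 ((some_some_mem_partHalfEdges X Y _).1 h)⟩) (by
    constructor
    · rintro (⟨⟨s, hs⟩, b⟩ | (_ | ⟨t, ht⟩)) (⟨⟨s', hs'⟩, b'⟩ | (_ | ⟨t', ht'⟩)) <;> simp
    · rintro ⟨⟨s, b⟩ | (_ | (_ | t)), h⟩
      · exact ⟨Sum.inl (⟨s, fun hs => h ((inl_mem_partHalfEdges X Y _).2 hs)⟩, b), rfl⟩
      · exact absurd (none_mem_partHalfEdges X Y) h
      · exact ⟨Sum.inr none, rfl⟩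
      · exact ⟨Sum.inr (some ⟨t, fun ht => h ((some_some_mem_partHalfEdges X Y _).2 ht)⟩), rfl⟩)

end

/-- A set of half-edges closed under gluing contains both or neither of the half-edges at each
`s`-vertex. Given the sides of the two new tails, it is therefore a free choice of `s`-vertices and
of old tails. -/
theorem sum_ite_glue_eq_sum_partHalfEdges (F : Finset (HalfEdge S (Option (Option T))) → B)
    {_ : ∀ Z : Finset (HalfEdge S (Option (Option T))), Decidable (Sum.inr none ∈ Z ∧
      Sum.inr (some none) ∉ Z ∧ ∀ x y, glue S (Option (Option T)) x y → (x ∈ Z ↔ y ∈ Z))} :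
    (∑ Z : Finset (HalfEdge S (Option (Option T))),
      if Sum.inr none ∈ Z ∧ Sum.inr (some none) ∉ Z ∧
        ∀ x y, glue S (Option (Option T)) x y → (x ∈ Z ↔ y ∈ Z) then F Z else 0) =
      ∑ X : Finset S, ∑ Y : Finset T, F (partHalfEdges X Y) := by
  rw [← Finset.sum_filter, ← Finset.sum_product', Finset.univ_product_univ]
  symm
  refine Finset.sum_bij' (fun XY _ => partHalfEdges XY.1 XY.2)
    (fun Z _ => (Finset.univ.filter fun s => Sum.inl (s, false) ∈ Z,
      Finset.univ.filter fun t => Sum.inr (some (some t)) ∈ Z)) ?_ (by simp) ?_ ?_ (by simp)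
  · rintro ⟨X, Y⟩ -
    rw [Finset.mem_filter]
    refine ⟨Finset.mem_univ _, none_mem_partHalfEdges X Y, some_none_notMem_partHalfEdges X Y, ?_⟩
    rintro _ _ ⟨s, rfl, rfl⟩
    rw [inl_mem_partHalfEdges, inl_mem_partHalfEdges]
  · rintro ⟨X, Y⟩ -
    simp [inl_mem_partHalfEdges, some_some_mem_partHalfEdges]
  · intro Z hZ
    obtain ⟨-, h1, h2, h3⟩ := Finset.mem_filter.1 hZ
    have h4 : ∀ s, Sum.inl (s, false) ∈ Z ↔ Sum.inl (s, true) ∈ Z :=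
      fun s => h3 _ _ ⟨s, rfl, rfl⟩
    ext (⟨s, _ | _⟩ | (_ | (_ | t)))
    · simp [inl_mem_partHalfEdges]
    · simp [inl_mem_partHalfEdges, h4]
    · simp [none_mem_partHalfEdges, h1]
    · simp [some_none_notMem_partHalfEdges, h2]
    · simp [some_some_mem_partHalfEdges]

/-- Cutting an `s`-vertex of a connected labelled graph. -/
theorem labelledSum_option [DecidableEq A] (α : (Fin r →₀ ℕ) → B) (p : Sym2 (Fin r)) (cs : S → Sym2 (Fin r))
    (ct : T → Fin r) :
    labelledSum α (fun x : Option S => x.elim p cs) ct A =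
      ∑ ij : {ij : Fin r × Fin r // s(ij.1, ij.2) = p},
        (labelledSum α cs
            (fun x : Option (Option T) => x.elim ij.1.1 fun y => y.elim ij.1.2 ct) A +
          ∑ X : Finset S, ∑ Y : Finset T, ∑ V : Finset A,
            labelledSum α (fun s : {s // s ∈ X} => cs s)
                (fun x : Option {t // t ∈ Y} => x.elim ij.1.1 fun t => ct t) {v // v ∈ V} *
              labelledSum α (fun s : {s // s ∉ X} => cs s)
                (fun x : Option {t // t ∉ Y} => x.elim ij.1.2 fun t => ct t) {v // v ∉ V}) := by
  have hsplit : ∀ (i j : Fin r) (o : Lift cs),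
      confSum α (halfColor o fun x : Option (Option T) => x.elim i fun y => y.elim j ct)
        (addPair (glue S (Option (Option T))) (Sum.inr none) (Sum.inr (some none))) A =
      confSum α (halfColor o fun x : Option (Option T) => x.elim i fun y => y.elim j ct)
        (glue S (Option (Option T))) A +
      ∑ X : Finset S, ∑ Y : Finset T, ∑ V : Finset A,
        confSum α (halfColor (cs := fun s : {s // s ∈ X} => cs s) (fun s => o s)
          (fun x : Option {t // t ∈ Y} => x.elim i fun t => ct t)) (glue _ _) {v // v ∈ V} *
        confSum α (halfColor (cs := fun s : {s // s ∉ X} => cs s) (fun s => o s)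
          (fun x : Option {t // t ∉ Y} => x.elim j fun t => ct t)) (glue _ _) {v // v ∉ V} := by
    intro i j o
    rw [confSum_addPair]
    congr 1
    refine (sum_ite_glue_eq_sum_partHalfEdges _).trans ?_
    refine Finset.sum_congr rfl fun X _ => Finset.sum_congr rfl fun Y _ =>
      Finset.sum_congr rfl fun V _ => ?_
    congr 1
    · symm
      refine confSum_congr α (partEquiv X Y) (Equiv.refl _) ?_ ?_
      · rintro (⟨s, b⟩ | (_ | t)) <;> rfl
      · intro x y
        constructor
        · rintro ⟨s, hx, hy⟩
          have hs : s ∈ X := by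
            have := (partEquiv X Y x).2
            rw [hx] at this
            exact (inl_mem_partHalfEdges X Y _).1 this
          refine ⟨⟨s, hs⟩, (partEquiv X Y).injective (Subtype.ext ?_),
            (partEquiv X Y).injective (Subtype.ext ?_)⟩
          · exact hx
          · exact hy
        · rintro ⟨s, rfl, rfl⟩
          exact ⟨s, rfl, rfl⟩
    · symm
      refine confSum_congr α (partComplEquiv X Y) (Equiv.refl _) ?_ ?_
      · rintro (⟨s, b⟩ | (_ | t)) <;> rfl
      · intro x y
        constructor
        · rintro ⟨s, hx, hy⟩
          have hs : s ∉ X := by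
            have := (partComplEquiv X Y x).2
            rw [hx] at this
            exact fun hs => this ((inl_mem_partHalfEdges X Y _).2 hs)
          refine ⟨⟨s, hs⟩, (partComplEquiv X Y).injective (Subtype.ext ?_),
            (partComplEquiv X Y).injective (Subtype.ext ?_)⟩
          · exact hx
          · exact hy
        · rintro ⟨s, rfl, rfl⟩
          exact ⟨s, rfl, rfl⟩
  rw [labelledSum_eq, Fintype.sum_equiv (liftOptionEquiv p cs) _
    (fun y => confSum α (halfColor ((liftOptionEquiv p cs).symm y) ct) (glue (Option S) T) A)
    fun o => by rw [Equiv.symm_apply_apply], Fintype.sum_prod_type]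
  refine Finset.sum_congr rfl fun ij _ => ?_
  simp only [confSum_option, hsplit]
  rw [Finset.sum_add_distrib]
  congr 1
  rw [Finset.sum_comm]
  refine Finset.sum_congr rfl fun X _ => ?_
  rw [Finset.sum_comm]
  refine Finset.sum_congr rfl fun Y _ => ?_
  rw [Finset.sum_comm]
  refine Finset.sum_congr rfl fun V _ => ?_
  -- An order of the colors at all `s`-vertices is a pair of independent orders on X and on its
  -- complement, so the sum over lifts becomes the product of two sums.
  rw [labelledSum_eq, labelledSum_eq, Finset.sum_mul_sum, ← Finset.sum_product',
    Finset.univ_product_univ]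
  exact Fintype.sum_equiv (Equiv.piEquivPiSubtypeProd (· ∈ X) _) _ _ fun o => rfl

end Labelled

end

end ColoredGraphs

namespace ColoredGraphs

noncomputable section

/-! ### Generating series with a variable for loops, and the cutting recursion. -/

section GenusSeries

open scoped Classical

variable {B : Type*} [CommRing B] [Algebra ℚ B]

/-- Binomial convolution of sequences, as a product of exponential generating functions. -/
theorem sum_choose_mul_eq_mul (t : B) {x y : ℕ → B} {k l : ℕ} (hx : ∀ m, k + 1 < m → x m = 0)
    (hy : ∀ m, l + 1 < m → y m = 0) :
    ∑ m ∈ Finset.range (k + l + 3), (1 / (m.factorial : ℚ)) • (t ^ (k + l + 2 - m) *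
        ∑ j ∈ Finset.range (m + 1), m.choose j • (x j * y (m - j))) =
      (∑ m ∈ Finset.range (k + 2), (1 / (m.factorial : ℚ)) • (t ^ (k + 1 - m) * x m)) *
        ∑ m ∈ Finset.range (l + 2), (1 / (m.factorial : ℚ)) • (t ^ (l + 1 - m) * y m) := by
  rw [Finset.sum_mul_sum, ← Finset.sum_product']
  rw [← Finset.sum_fiberwise_of_maps_to (g := fun ij : ℕ × ℕ => ij.1 + ij.2)
    (t := Finset.range (k + l + 3))]
  · refine Finset.sum_congr rfl fun m _ => ?_
    rw [← Finset.Nat.sum_antidiagonal_eq_sum_range_succ fun i j => m.choose i • (x i * y j),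
      Finset.mul_sum, Finset.smul_sum]
    symm
    -- Pairs with sum m outside the rectangle contribute nothing, because one of the two sequences
    -- vanishes there.
    refine Finset.sum_subset_zero_on_sdiff ?_ ?_ ?_
    · intro ij hij
      rw [Finset.mem_filter] at hij
      exact Finset.HasAntidiagonal.mem_antidiagonal.2 hij.2
    · intro ij hij
      rw [Finset.mem_sdiff, Finset.HasAntidiagonal.mem_antidiagonal, Finset.mem_filter, Finset.mem_product,
        Finset.mem_range, Finset.mem_range] at hij
      by_cases h : ij.1 < k + 2
      · rw [hy ij.2 (by by_contra h'; exact hij.2 ⟨⟨h, by omega⟩, hij.1⟩)]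
        simp
      · rw [hx ij.1 (by omega)]
        simp
    · intro ij hij
      rw [Finset.mem_filter, Finset.mem_product, Finset.mem_range, Finset.mem_range] at hij
      obtain ⟨⟨h1, h2⟩, rfl⟩ := hij
      -- Inside the rectangle both truncated subtractions are genuine, so the exponents of t add up.
      rw [smul_mul_smul_comm, ← Nat.cast_smul_eq_nsmul ℚ, mul_smul_comm, smul_smul,
        show k + l + 2 - (ij.1 + ij.2) = (k + 1 - ij.1) + (l + 1 - ij.2) by omega, pow_add]
      congr 1
      · rw [Nat.choose_symm_add, Nat.add_choose, Nat.cast_div (Nat.factorial_mul_factorial_dvd_factorial_add _ _)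
          (by positivity)]
        push_cast
        field_simp
      · ring
  · intro ij hij
    rw [Finset.mem_product, Finset.mem_range, Finset.mem_range] at hij
    rw [Finset.mem_range]
    omega

variable {r : ℕ} {S T : Type} [Fintype S] [Fintype T]

/-- The generating series by genus of all connected graphs with labelled `s`-vertices and tails of
given colors. -/
def genusSeries (t : B) (α : (Fin r →₀ ℕ) → B) (cs : S → Sym2 (Fin r)) (ct : T → Fin r) : B :=
  -- A connected graph with m `a`-vertices has 2|S| edges, hence b₁ = |S| + 1 - m, the exponent of
  -- t; m ≤ |S| + 1 is the largest possible value. The factors 1/2 and 1/m! undo the orders at the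
  -- `s`-vertices and the numbering of the `a`-vertices.
  (1 / 2 : ℚ) ^ Fintype.card S • ∑ m ∈ Finset.range (Fintype.card S + 2),
    (1 / (m.factorial : ℚ)) • (t ^ (Fintype.card S + 1 - m) * labelledSum α cs ct (Fin m))

/-- Cutting an `s`-vertex, in terms of generating series. -/
theorem genusSeries_option (t : B) (α : (Fin r →₀ ℕ) → B) (p : Sym2 (Fin r))
    (cs : S → Sym2 (Fin r)) (ct : T → Fin r) :
    genusSeries t α (fun x : Option S => x.elim p cs) ct =
      (1 / 2 : ℚ) • ∑ ij : {ij : Fin r × Fin r // s(ij.1, ij.2) = p},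
        (t * genusSeries t α cs
            (fun x : Option (Option T) => x.elim ij.1.1 fun y => y.elim ij.1.2 ct) +
          ∑ X : Finset S, ∑ Y : Finset T,
            genusSeries t α (fun s : {s // s ∈ X} => cs s)
                (fun x : Option {t // t ∈ Y} => x.elim ij.1.1 fun t => ct t) *
              genusSeries t α (fun s : {s // s ∉ X} => cs s)
                (fun x : Option {t // t ∉ Y} => x.elim ij.1.2 fun t => ct t)) := by
  -- The summand depends on V only through its cardinality, which produces the binomial coefficients
  -- of an exponential convolution.
  have hV : ∀ {S₀ S₁ T₀ T₁ : Type} [Fintype S₀] [Fintype S₁] [Fintype T₀] [Fintype T₁]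
      (cs₀ : S₀ → Sym2 (Fin r)) (ct₀ : T₀ → Fin r) (cs₁ : S₁ → Sym2 (Fin r)) (ct₁ : T₁ → Fin r)
      (m : ℕ), ∑ V : Finset (Fin m), labelledSum α cs₀ ct₀ {v // v ∈ V} *
          labelledSum α cs₁ ct₁ {v // v ∉ V} =
        ∑ j ∈ Finset.range (m + 1), m.choose j •
          (labelledSum α cs₀ ct₀ (Fin j) * labelledSum α cs₁ ct₁ (Fin (m - j))) := by
    intro S₀ S₁ T₀ T₁ _ _ _ _ cs₀ ct₀ cs₁ ct₁ m
    have := Finset.sum_powerset_apply_card (x := (Finset.univ : Finset (Fin m)))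
      fun j => labelledSum α cs₀ ct₀ (Fin j) * labelledSum α cs₁ ct₁ (Fin (m - j))
    rw [Finset.card_univ, Fintype.card_fin, Finset.powerset_univ] at this
    rw [← this]
    refine Finset.sum_congr rfl fun V _ => ?_
    rw [labelledSum_eq_labelledSum_fin (A := {v // v ∈ V}),
      labelledSum_eq_labelledSum_fin (A := {v // v ∉ V}), Fintype.card_subtype_compl,
      Fintype.card_fin, Fintype.card_coe]
  have hprod : ∀ (i j : Fin r) (X : Finset S) (Y : Finset T),
      (1 / 2 : ℚ) ^ Fintype.card S • ∑ m ∈ Finset.range (Fintype.card S + 3),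
        (1 / (m.factorial : ℚ)) • (t ^ (Fintype.card S + 2 - m) * ∑ V : Finset (Fin m),
            labelledSum α (fun s : {s // s ∈ X} => cs s)
                (fun x : Option {t // t ∈ Y} => x.elim i fun t => ct t) {v // v ∈ V} *
              labelledSum α (fun s : {s // s ∉ X} => cs s)
                (fun x : Option {t // t ∉ Y} => x.elim j fun t => ct t) {v // v ∉ V}) =
      genusSeries t α (fun s : {s // s ∈ X} => cs s)
                (fun x : Option {t // t ∈ Y} => x.elim i fun t => ct t) *
              genusSeries t α (fun s : {s // s ∉ X} => cs s)
                (fun x : Option {t // t ∉ Y} => x.elim j fun t => ct t) := by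
    intro i j X Y
    have hcard : Fintype.card S = Fintype.card {s // s ∈ X} + Fintype.card {s // s ∉ X} := by
      rw [Fintype.card_subtype_compl, Fintype.card_coe]
      have := X.card_le_univ
      omega
    simp only [hV]
    rw [genusSeries, genusSeries, smul_mul_smul_comm, ← pow_add, ← sum_choose_mul_eq_mul, ← hcard]
    · exact fun m hm => labelledSum_eq_zero _ _ _ (by rwa [Fintype.card_fin])
    · exact fun m hm => labelledSum_eq_zero _ _ _ (by rwa [Fintype.card_fin])
  have hlin : ∀ i j : Fin r, (1 / 2 : ℚ) ^ Fintype.card S •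
      ∑ m ∈ Finset.range (Fintype.card S + 3), (1 / (m.factorial : ℚ)) •
        (t ^ (Fintype.card S + 2 - m) * labelledSum α cs
            (fun x : Option (Option T) => x.elim i fun y => y.elim j ct) (Fin m)) =
      t * genusSeries t α cs (fun x : Option (Option T) => x.elim i fun y => y.elim j ct) := by
    intro i j
    -- The top value m = |S| + 2 is excluded for a graph with one `s`-vertex less; the loop broken
    -- by a nonseparating cut accounts for the remaining factor t.
    rw [Finset.sum_range_succ, labelledSum_eq_zero _ _ _ (by rw [Fintype.card_fin]; omega),
      mul_zero, smul_zero, add_zero, genusSeries, mul_smul_comm, Finset.mul_sum]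
    congr 1
    refine Finset.sum_congr rfl fun m hm => ?_
    rw [Finset.mem_range] at hm
    rw [mul_smul_comm, ← mul_assoc, ← pow_succ',
      show Fintype.card S + 2 - m = Fintype.card S + 1 - m + 1 by omega]
  simp only [← hlin, ← hprod]
  rw [genusSeries, Fintype.card_option, add_assoc _ 1 2, add_assoc _ 1 1, one_add_one_eq_two,
    show 1 + 2 = 3 from rfl, pow_succ', mul_smul]
  congr 1
  simp only [labelledSum_option, Finset.mul_sum, mul_add, Finset.smul_sum, smul_add,
    Finset.sum_add_distrib]
  congr 1
  · rw [Finset.sum_comm]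
  · rw [Finset.sum_comm]
    refine Finset.sum_congr rfl fun ij _ => ?_
    rw [Finset.sum_comm]
    refine Finset.sum_congr rfl fun X _ => ?_
    rw [Finset.sum_comm]

end GenusSeries

end

end ColoredGraphs

namespace ColoredGraphs

noncomputable section

/-! ### Isomorphisms and labellings of graphs -/

namespace BipGraph

variable {r : ℕ} {A S E T A' S' E' T' A'' S'' E'' T'' : Type}
  {Γ : BipGraph r A S E T} {Γ' : BipGraph r A' S' E' T'} {Γ'' : BipGraph r A'' S'' E'' T''}

/-- The inverse isomorphism. -/
def Iso.symm (f : Iso Γ Γ') : Iso Γ' Γ where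
  onA := f.onA.symm
  onS := f.onS.symm
  onE := f.onE.symm
  onT := f.onT.symm
  aEnd_eq e := by rw [Equiv.eq_symm_apply, ← f.aEnd_eq, Equiv.apply_symm_apply]
  sEnd_eq e := by rw [Equiv.eq_symm_apply, ← f.sEnd_eq, Equiv.apply_symm_apply]
  base_eq t := by rw [Equiv.eq_symm_apply, ← f.base_eq, Equiv.apply_symm_apply]
  edgeColor_eq e := by rw [← f.edgeColor_eq, Equiv.apply_symm_apply]
  tailColor_eq t := by rw [← f.tailColor_eq, Equiv.apply_symm_apply]
  vGenus_eq v := by rw [← f.vGenus_eq, Equiv.apply_symm_apply]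

/-- The composition of isomorphisms. -/
def Iso.trans (f : Iso Γ Γ') (h : Iso Γ' Γ'') : Iso Γ Γ'' where
  onA := f.onA.trans h.onA
  onS := f.onS.trans h.onS
  onE := f.onE.trans h.onE
  onT := f.onT.trans h.onT
  aEnd_eq e := by simp [h.aEnd_eq, f.aEnd_eq]
  sEnd_eq e := by simp [h.sEnd_eq, f.sEnd_eq]
  base_eq t := by simp [h.base_eq, f.base_eq]
  edgeColor_eq e := by simp [h.edgeColor_eq, f.edgeColor_eq]
  tailColor_eq t := by simp [h.tailColor_eq, f.tailColor_eq]
  vGenus_eq v := by simp [h.vGenus_eq, f.vGenus_eq]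

/-- Composing with a fixed isomorphism. -/
def Iso.transEquiv (f : Iso Γ' Γ'') : Iso Γ Γ' ≃ Iso Γ Γ'' where
  toFun h := h.trans f
  invFun h := h.trans f.symm
  left_inv h := by ext <;> simp [Iso.trans, Iso.symm]
  right_inv h := by ext <;> simp [Iso.trans, Iso.symm]

theorem Iso.isConnected_iff (f : Iso Γ Γ') : Γ.IsConnected ↔ Γ'.IsConnected := by
  let e : Γ.skeleton ≃g Γ'.skeleton :=
    { toEquiv := f.onA.sumCongr f.onS
      map_rel_iff' := by
        rintro (v | s) (w | s') <;>
          simp only [skeleton, SimpleGraph.fromRel_adj, Equiv.sumCongr_apply, Sum.map_inl,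
            Sum.map_inr, Sum.inl.injEq, Sum.inr.injEq, reduceCtorEq, ne_eq, and_false, false_and,
            exists_false, or_false, false_or, not_false_iff, true_and]
        all_goals
          constructor
          · rintro ⟨x, h1, h2⟩
            refine ⟨f.onE.symm x, ?_, ?_⟩
            · rw [← f.onA.apply_eq_iff_eq, h1, ← f.aEnd_eq, Equiv.apply_symm_apply]
            · rw [← f.onS.apply_eq_iff_eq, h2, ← f.sEnd_eq, Equiv.apply_symm_apply]
          · rintro ⟨x, rfl, rfl⟩
            exact ⟨f.onE x, by simp [f.aEnd_eq], by simp [f.sEnd_eq]⟩ }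
  exact e.connected_iff

theorem Iso.valence_eq (f : Iso Γ Γ') (v : A) : Γ'.valence (f.onA v) = Γ.valence v := by
  ext i
  simp only [valence, Finsupp.equivFunOnFinite_symm_apply_apply]
  congr 1
  · refine (Nat.card_congr (f.onE.subtypeEquiv fun e => ?_)).symm
    rw [f.aEnd_eq, f.edgeColor_eq, f.onA.apply_eq_iff_eq]
  · refine (Nat.card_congr (f.onT.subtypeEquiv fun t => ?_)).symm
    rw [f.base_eq, f.tailColor_eq, f.onA.apply_eq_iff_eq]

theorem Iso.vertexWeight_eq {R : Type*} [CommRing R] [Fintype A] [Fintype A']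
    (a : ℕ → (Fin r →₀ ℕ) → R) (f : Iso Γ Γ') : Γ.vertexWeight a = Γ'.vertexWeight a :=
  Fintype.prod_equiv f.onA _ _ fun v => by rw [f.vGenus_eq, f.valence_eq]

/-- The number of components cancels between b₁ and -b₀, so the genus needs only cardinalities. -/
theorem genus_eq [Fintype A] (Γ : BipGraph r A S E T) :
    Γ.genus = ∑ v, (Γ.vGenus v : ℤ) + Nat.card E - Nat.card A - Nat.card S + 1 := by
  rw [genus, b1]
  ring

theorem Iso.genus_eq [Fintype A] [Fintype A'] (f : Iso Γ Γ') : Γ.genus = Γ'.genus := by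
  rw [Γ.genus_eq, Γ'.genus_eq, Nat.card_congr f.onA, Nat.card_congr f.onE, Nat.card_congr f.onS,
    Fintype.sum_equiv f.onA _ (fun v => (Γ'.vGenus v : ℤ)) fun v => by rw [f.vGenus_eq]]

theorem exists_edges (Γ : BipGraph r A S E T) (s : S) :
    ∃ e e' : E, e ≠ e' ∧ Γ.sEnd e = s ∧ Γ.sEnd e' = s ∧ ∀ x, Γ.sEnd x = s → x = e ∨ x = e' := by
  obtain ⟨⟨e, he⟩, ⟨e', he'⟩, hne, huniv⟩ := Nat.card_eq_two_iff.1 (Γ.two_valent s)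
  refine ⟨e, e', fun h => hne (Subtype.ext h), he, he', fun x hx => ?_⟩
  have : (⟨x, hx⟩ : {e : E // Γ.sEnd e = s}) ∈ ({⟨e, he⟩, ⟨e', he'⟩} : Set _) :=
    huniv ▸ Set.mem_univ _
  simpa using this

/-- The unordered pair of the colors of the two edges at an `s`-vertex. -/
def pairColor (Γ : BipGraph r A S E T) (s : S) : Sym2 (Fin r) :=
  s(Γ.edgeColor (Γ.exists_edges s).choose, Γ.edgeColor (Γ.exists_edges s).choose_spec.choose)

/-- The two edges chosen in the definition are the only ones at the vertex, and the pair of colors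
is unordered, so the choice is immaterial. -/
theorem pairColor_eq (Γ : BipGraph r A S E T) {s : S} {e e' : E} (hne : e ≠ e')
    (he : Γ.sEnd e = s) (he' : Γ.sEnd e' = s) :
    Γ.pairColor s = s(Γ.edgeColor e, Γ.edgeColor e') := by
  obtain ⟨-, -, -, h⟩ := (Γ.exists_edges s).choose_spec.choose_spec
  rw [pairColor]
  generalize (Γ.exists_edges s).choose_spec.choose = x' at h ⊢
  generalize (Γ.exists_edges s).choose = x at h ⊢
  rcases h e he with h1 | h1 <;> rcases h e' he' with h2 | h2
  · exact absurd (h1.trans h2.symm) hne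
  · rw [h1, h2]
  · rw [h1, h2, Sym2.eq_swap]
  · exact absurd (h1.trans h2.symm) hne

theorem Iso.pairColor_eq (f : Iso Γ Γ') (s : S) : Γ'.pairColor (f.onS s) = Γ.pairColor s := by
  obtain ⟨e, e', hne, he, he', -⟩ := Γ.exists_edges s
  rw [Γ.pairColor_eq hne he he', Γ'.pairColor_eq (e := f.onE e) (e' := f.onE e')
    (f.onE.injective.ne hne) (by rw [f.sEnd_eq, he]) (by rw [f.sEnd_eq, he']),
    f.edgeColor_eq, f.edgeColor_eq]

theorem exponent_inl (Γ : BipGraph r A S E T) (p : Sym2 (Fin r)) :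
    Γ.exponent (Sum.inl p) = Nat.card {s // Γ.pairColor s = p} := by
  simp only [exponent, Finsupp.equivFunOnFinite_symm_apply_apply, Sum.elim_inl, sCount]
  refine Nat.card_congr (Equiv.subtypeEquivRight fun s => ⟨?_, ?_⟩)
  · rintro ⟨e, e', hne, he, he', rfl⟩
    exact Γ.pairColor_eq hne he he'
  · rintro rfl
    obtain ⟨e, e', hne, he, he', -⟩ := Γ.exists_edges s
    exact ⟨e, e', hne, he, he', Γ.pairColor_eq hne he he'⟩

theorem exponent_inr (Γ : BipGraph r A S E T) (i : Fin r) :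
    Γ.exponent (Sum.inr i) = Nat.card {t // Γ.tailColor t = i} := by
  simp only [exponent, Finsupp.equivFunOnFinite_symm_apply_apply, Sum.elim_inr, tailCount]

theorem Iso.exponent_eq (f : Iso Γ Γ') : Γ.exponent = Γ'.exponent := by
  ext (p | i)
  · rw [exponent_inl, exponent_inl]
    exact Nat.card_congr (f.onS.subtypeEquiv fun s => by rw [f.pairColor_eq])
  · rw [exponent_inr, exponent_inr]
    exact Nat.card_congr (f.onT.subtypeEquiv fun t => by rw [f.tailColor_eq])

instance [Finite A] [Finite S] [Finite E] [Finite T] : Finite (Iso Γ Γ') := by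
  by_cases h : Nonempty (Iso Γ Γ')
  · obtain ⟨f⟩ := h
    have := Finite.of_equiv A f.onA
    have := Finite.of_equiv S f.onS
    have := Finite.of_equiv E f.onE
    have := Finite.of_equiv T f.onT
    refine Finite.of_injective (fun f : Iso Γ Γ' => (f.onA, f.onS, f.onE, f.onT)) fun f g h => ?_
    simp only [Prod.mk.injEq] at h
    ext1
    · exact h.1
    · exact h.2.1
    · exact h.2.2.1
    · exact h.2.2.2
  · rw [not_nonempty_iff] at h
    infer_instance

theorem autCard_pos [Finite A] [Finite S] [Finite E] [Finite T] : 0 < Γ.autCard :=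
  Nat.card_pos_iff.2 ⟨⟨⟨Equiv.refl _, Equiv.refl _, Equiv.refl _, Equiv.refl _, fun _ => rfl,
    fun _ => rfl, fun _ => rfl, fun _ => rfl, fun _ => rfl, fun _ => rfl⟩⟩, inferInstance⟩

/-- Every finite graph has an isomorphism class. -/
theorem exists_graphClass [Finite A] [Finite S] [Finite E] [Finite T] (Γ : BipGraph r A S E T) :
    ∃ c : GraphClass r, Nonempty (Iso Γ c.rep.graph) := by
  have eA := Finite.equivFin A
  have eS := Finite.equivFin S
  have eE := Finite.equivFin E
  have eT := Finite.equivFin T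
  let Γ₁ : FinGraph r :=
    { nA := Nat.card A
      nS := Nat.card S
      nE := Nat.card E
      nT := Nat.card T
      graph :=
        { aEnd := eA ∘ Γ.aEnd ∘ eE.symm
          sEnd := eS ∘ Γ.sEnd ∘ eE.symm
          base := eA ∘ Γ.base ∘ eT.symm
          edgeColor := Γ.edgeColor ∘ eE.symm
          tailColor := Γ.tailColor ∘ eT.symm
          vGenus := Γ.vGenus ∘ eA.symm
          two_valent := fun s => by
            rw [← Γ.two_valent (eS.symm s)]
            refine Nat.card_congr (eE.symm.subtypeEquiv fun e => ?_)
            rw [Function.comp_apply, Function.comp_apply, Equiv.eq_symm_apply] } }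
  let f : Iso Γ Γ₁.graph :=
    ⟨eA, eS, eE, eT, fun e => by simp [Γ₁], fun e => by simp [Γ₁], fun e => by simp [Γ₁],
      fun e => by simp [Γ₁], fun e => by simp [Γ₁], fun e => by simp [Γ₁]⟩
  refine ⟨Quotient.mk _ Γ₁, ?_⟩
  obtain ⟨h⟩ : Γ₁ ≈ (Quotient.mk (FinGraph.setoid r) Γ₁).out :=
    Setoid.symm (Quotient.mk_out Γ₁)
  exact ⟨f.trans h⟩

theorem graphClass_eq {c c' : GraphClass r} (h : Nonempty (Iso c.rep.graph c'.rep.graph)) :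
    c = c' := by
  rw [← Quotient.out_eq c, ← Quotient.out_eq c']
  exact Quotient.sound h

/-- The isomorphism class of a finite graph. -/
def toClass [Finite A] [Finite S] [Finite E] [Finite T] (Γ : BipGraph r A S E T) : GraphClass r :=
  Γ.exists_graphClass.choose

theorem toClass_eq_iff [Finite A] [Finite S] [Finite E] [Finite T] (Γ : BipGraph r A S E T)
    (c : GraphClass r) : Γ.toClass = c ↔ Nonempty (Iso c.rep.graph Γ) := by
  obtain ⟨f⟩ := Γ.exists_graphClass.choose_spec
  constructor
  · rintro rfl
    exact ⟨f.symm⟩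
  · rintro ⟨h⟩
    exact (graphClass_eq ⟨h.trans f⟩).symm

end BipGraph

end

end ColoredGraphs

namespace ColoredGraphs

noncomputable section

/-! ### Labelled graphs and the number of labellings of a graph. -/

section Labellings

open scoped Classical

/-- The number of bijections that respect given colorings. -/
theorem card_equiv_comp_eq {X Y C : Type} [Finite X] [Finite Y] [Fintype C] (f : X → C)
    (g : Y → C) (n : C → ℕ) (hf : ∀ c, Nat.card {x // f x = c} = n c)
    (hg : ∀ c, Nat.card {y // g y = c} = n c) :
    Nat.card {e : X ≃ Y // ∀ x, g (e x) = f x} = ∏ c, (n c).factorial := by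
  have hfib : ∀ c, Nonempty ({x // f x = c} ≃ {y // g y = c}) := by
    exact fun c => Finite.card_eq.1 ((hf c).trans (hg c).symm)
  -- One color-preserving bijection is assembled fiber by fiber; the others differ from it by
  -- permutations that preserve the coloring, which are counted by a stabilizer.
  let e₀ : X ≃ Y := (Equiv.sigmaFiberEquiv f).symm.trans
    ((Equiv.sigmaCongrRight fun c => (hfib c).some).trans (Equiv.sigmaFiberEquiv g))
  have he₀ : ∀ x, g (e₀ x) = f x := fun x => ((hfib (f x)).some ⟨x, rfl⟩).2
  have := Fintype.ofFinite X
  calc Nat.card {e : X ≃ Y // ∀ x, g (e x) = f x}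
      = Nat.card {σ : Equiv.Perm X // f ∘ σ = f} := by
        refine Nat.card_congr (((Equiv.refl X).equivCongr e₀.symm).subtypeEquiv fun e => ?_)
        rw [funext_iff]
        refine forall_congr' fun x => ?_
        have : f (((Equiv.refl X).equivCongr e₀.symm) e x) = g (e x) := by
          rw [← he₀]; simp
        rw [Function.comp_apply, this]
    _ = _ := by
        rw [Nat.card_eq_fintype_card, DomMulAct.stabilizer_card]
        exact Finset.prod_congr rfl fun c _ => by rw [← hf c, Nat.card_eq_fintype_card]

variable {r : ℕ} {S T A : Type} {cs : S → Sym2 (Fin r)} {ct : T → Fin r}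

/-- The exponent of the monomial of a graph whose `s`-vertices and tails have given colors. -/
def colorExponent [Fintype S] [Fintype T] (cs : S → Sym2 (Fin r)) (ct : T → Fin r) :
    (Sym2 (Fin r) ⊕ Fin r) →₀ ℕ :=
  ∑ s, Finsupp.single (Sum.inl (cs s)) 1 + ∑ t, Finsupp.single (Sum.inr (ct t)) 1

theorem colorExponent_inl [Fintype S] [Fintype T] (cs : S → Sym2 (Fin r)) (ct : T → Fin r)
    (p : Sym2 (Fin r)) : colorExponent cs ct (Sum.inl p) = Nat.card {s // cs s = p} := by
  rw [colorExponent, Finsupp.add_apply, Finsupp.finsetSum_apply, Finsupp.finsetSum_apply,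
    Nat.card_eq_fintype_card, Fintype.card_subtype, Finset.card_filter]
  simp [Finsupp.single_apply]

theorem colorExponent_inr [Fintype S] [Fintype T] (cs : S → Sym2 (Fin r)) (ct : T → Fin r)
    (i : Fin r) : colorExponent cs ct (Sum.inr i) = Nat.card {t // ct t = i} := by
  rw [colorExponent, Finsupp.add_apply, Finsupp.finsetSum_apply, Finsupp.finsetSum_apply,
    Nat.card_eq_fintype_card, Fintype.card_subtype, Finset.card_filter]
  simp [Finsupp.single_apply]

/-- The additional data of a graph whose `s`-vertices and tails are labelled and have given colors:
the genera of the `a`-vertices, the orders of the colors at the `s`-vertices, and the `a`-vertices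
at which the half-edges are attached. -/
abbrev LabelledData (cs : S → Sym2 (Fin r)) (T A : Type) : Type :=
  (A → ℕ) × Lift cs × (HalfEdge S T → A)

theorem card_fst_eq (s : S) : Nat.card {e : S × Bool // e.1 = s} = 2 := by
  rw [← Nat.card_congr (Equiv.ofBijective (fun b : Bool => (⟨(s, b), rfl⟩ :
    {e : S × Bool // e.1 = s})) ⟨fun b b' h => by simpa using h, ?_⟩)]
  · simp
  · rintro ⟨⟨_, b⟩, rfl⟩
    exact ⟨b, rfl⟩

/-- The graph with given `s`-vertices and tails. -/
def labelledGraph (ct : T → Fin r) (x : LabelledData cs T A) : BipGraph r A S (S × Bool) T where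
  aEnd e := x.2.2 (Sum.inl e)
  sEnd e := e.1
  base t := x.2.2 (Sum.inr t)
  edgeColor e := halfColor x.2.1 ct (Sum.inl e)
  tailColor := ct
  vGenus := x.1
  two_valent := card_fst_eq

theorem pairColor_labelledGraph (x : LabelledData cs T A) (s : S) :
    (labelledGraph ct x).pairColor s = cs s := by
  rw [BipGraph.pairColor_eq (s := s) (e := (s, false)) (e' := (s, true)) _ (by simp) rfl rfl]
  exact (x.2.1 s).2

theorem exponent_labelledGraph [Fintype S] [Fintype T] (x : LabelledData cs T A) :
    (labelledGraph ct x).exponent = colorExponent cs ct := by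
  ext (p | i)
  · rw [BipGraph.exponent_inl, colorExponent_inl]
    simp only [pairColor_labelledGraph]
  · rw [BipGraph.exponent_inr, colorExponent_inr]
    rfl

theorem valence_labelledGraph [Fintype S] [Fintype T] (x : LabelledData cs T A) (v : A) :
    (labelledGraph ct x).valence v = confValence (halfColor x.2.1 ct) x.2.2 v := by
  ext i
  rw [confValence, Fintype.sum_sum_type, Finsupp.add_apply, Finsupp.finsetSum_apply,
    Finsupp.finsetSum_apply, BipGraph.valence, Finsupp.equivFunOnFinite_symm_apply_apply]
  congr 1
  · rw [Nat.card_eq_fintype_card, Fintype.card_subtype, Finset.card_filter]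
    refine Finset.sum_congr rfl fun e _ => ?_
    by_cases h1 : x.2.2 (Sum.inl e) = v <;>
      simp [labelledGraph, h1, Finsupp.single_apply]
  · rw [Nat.card_eq_fintype_card, Fintype.card_subtype, Finset.card_filter]
    refine Finset.sum_congr rfl fun t _ => ?_
    by_cases h1 : x.2.2 (Sum.inr t) = v <;>
      simp [labelledGraph, halfColor, h1, Finsupp.single_apply]

theorem genus_labelledGraph [Fintype S] [Fintype A] (x : LabelledData cs T A) :
    (labelledGraph ct x).genus =
      ∑ v, (x.1 v : ℤ) + Fintype.card S - Fintype.card A + 1 := by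
  rw [BipGraph.genus_eq, Nat.card_prod, Nat.card_eq_fintype_card (α := S),
    Nat.card_eq_fintype_card (α := A)]
  simp [labelledGraph]
  ring

/-- Each `s`-vertex is adjacent to the `a`-vertices of its two half-edges, so components of the
bipartite graph correspond to minimal saturated sets of `a`-vertices. -/
theorem isConnected_labelledGraph_iff [Fintype A] (x : LabelledData cs T A) :
    (labelledGraph ct x).IsConnected ↔ ConnectedOn (glue S T) x.2.2 Finset.univ := by
  set Γ := labelledGraph ct x
  have hadj : ∀ e : S × Bool, Γ.skeleton.Adj (Sum.inl (x.2.2 (Sum.inl e))) (Sum.inr e.1) :=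
    fun e => (SimpleGraph.fromRel_adj _ _ _).2 ⟨by simp, Or.inl ⟨e, rfl, rfl⟩⟩
  constructor
  · intro h
    have hne : Nonempty A := by
      obtain ⟨v | s⟩ := h.nonempty
      · exact ⟨v⟩
      · exact ⟨x.2.2 (Sum.inl (s, false))⟩
    refine ⟨Finset.univ_nonempty, fun P _ hP => ?_⟩
    -- A saturated set is extended to the `s`-vertices by testing one end; saturation makes the
    -- choice of end irrelevant and Q constant along edges.
    let Q : A ⊕ S → Prop := Sum.elim (· ∈ P) fun s => x.2.2 (Sum.inl (s, false)) ∈ P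
    have hQe : ∀ e : S × Bool, x.2.2 (Sum.inl e) ∈ P ↔ x.2.2 (Sum.inl (e.1, false)) ∈ P := by
      rintro ⟨s, _ | _⟩
      · exact Iff.rfl
      · exact (hP _ _ ⟨s, rfl, rfl⟩).symm
    have hQ : ∀ y z, Γ.skeleton.Adj y z → (Q y ↔ Q z) := by
      intro y z hyz
      rcases ((SimpleGraph.fromRel_adj _ _ _).1 hyz).2 with ⟨e, rfl, rfl⟩ | ⟨e, rfl, rfl⟩
      · exact hQe e
      · exact (hQe e).symm
    have hall : ∀ y z, Q y ↔ Q z := by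
      intro y z
      obtain ⟨w⟩ := h.preconnected y z
      induction w with
      | nil => rfl
      | cons hyz _ ih => exact (hQ _ _ hyz).trans ih
    by_cases hPe : P = ∅
    · exact Or.inl hPe
    · obtain ⟨v, hv⟩ := Finset.nonempty_iff_ne_empty.2 hPe
      exact Or.inr (Finset.eq_univ_iff_forall.2 fun w => (hall (Sum.inl v) (Sum.inl w)).1 hv)
  · intro h
    obtain ⟨v, -⟩ := h.1
    have hsat : Saturated (glue S T) x.2.2
        (Finset.univ.filter fun w => Γ.skeleton.Reachable (Sum.inl v) (Sum.inl w)) := by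
      rintro _ _ ⟨s, rfl, rfl⟩
      have := (hadj (s, false)).reachable.trans (hadj (s, true)).symm.reachable
      simp only [Finset.mem_filter, Finset.mem_univ, true_and]
      exact ⟨fun hr => hr.trans this, fun hr => hr.trans this.symm⟩
    have hA : ∀ w, Γ.skeleton.Reachable (Sum.inl v) (Sum.inl w) := by
      rcases h.2 _ (Finset.subset_univ _) hsat with he | he
      · exact absurd (he ▸ Finset.mem_filter.2 ⟨Finset.mem_univ v, SimpleGraph.Reachable.refl _⟩)
          (Finset.notMem_empty v)
      · intro w
        have hw := Finset.mem_univ w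
        rw [← he] at hw
        exact (Finset.mem_filter.1 hw).2
    have hall : ∀ y, Γ.skeleton.Reachable (Sum.inl v) y := by
      rintro (w | s)
      · exact hA w
      · exact (hA _).trans (hadj (s, false)).reachable
    exact { preconnected := fun y z => (hall y).symm.trans (hall z), nonempty := ⟨Sum.inl v⟩ }

variable {A' S' E' T' : Type}

/-- The number of labellings of a graph. -/
theorem card_sigma_iso_labelledGraph [Fintype S] [Fintype T] [Fintype A] [Finite A'] [Finite S']
    [Finite E'] [Finite T'] (Γ : BipGraph r A' S' E' T') (hA : Nat.card A' = Fintype.card A)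
    (hΓ : Γ.exponent = colorExponent cs ct) :
    Nat.card (Σ x : LabelledData cs T A, BipGraph.Iso Γ (labelledGraph ct x)) =
      (Fintype.card A).factorial * (∏ v, (colorExponent cs ct v).factorial) *
        2 ^ Fintype.card S := by
  let Lab := {σ : S' ≃ S // ∀ s, cs (σ s) = Γ.pairColor s}
  let Lab₂ : Lab → Type := fun σ => {ε : E' ≃ S × Bool // ∀ e, (ε e).1 = σ.1 (Γ.sEnd e)}
  let F : (Σ x : LabelledData cs T A, BipGraph.Iso Γ (labelledGraph ct x)) →
      (A' ≃ A) × (Σ σ : Lab, Lab₂ σ) × {τ : T' ≃ T // ∀ t, ct (τ t) = Γ.tailColor t} :=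
    fun y => (y.2.onA, ⟨⟨y.2.onS, fun s => by
      rw [← pairColor_labelledGraph (ct := ct) y.1, y.2.pairColor_eq]⟩,
      ⟨y.2.onE, y.2.sEnd_eq⟩⟩, ⟨y.2.onT, y.2.tailColor_eq⟩)
  -- The labelled data are recovered by transport of structure along the four bijections, so only
  -- these have to be counted: |A|! for the `a`-vertices, color-preserving ones for `s`-vertices and
  -- tails, and two orders of the edges at each `s`-vertex.
  have hF : Function.Bijective F := by
    constructor
    · rintro ⟨⟨γ, o, φ⟩, f⟩ ⟨⟨γ', o', φ'⟩, f'⟩ h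
      have h1 : f.onA = f'.onA := congrArg (fun y => y.1) h
      have h2 : f.onS = f'.onS := congrArg (fun y => y.2.1.1.1) h
      have h3 : f.onE = f'.onE := congrArg (fun y => y.2.1.2.1) h
      have h4 : f.onT = f'.onT := congrArg (fun y => y.2.2.1) h
      have hγ : γ = γ' := by
        funext v
        obtain ⟨w, rfl⟩ := f.onA.surjective v
        have e1 := f.vGenus_eq w
        have e2 := f'.vGenus_eq w
        rw [← h1] at e2
        exact e1.trans e2.symm
      have ho : o = o' := by
        have hcol : ∀ e, halfColor o ct (Sum.inl e) = halfColor o' ct (Sum.inl e) := by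
          intro e
          obtain ⟨e, rfl⟩ := f.onE.surjective e
          have e1 := f.edgeColor_eq e
          have e2 := f'.edgeColor_eq e
          rw [← h3] at e2
          exact e1.trans e2.symm
        funext s
        exact Subtype.ext (Prod.ext (hcol (s, false)) (hcol (s, true)))
      have hφ : φ = φ' := by
        funext y
        rcases y with e | t
        · obtain ⟨e, rfl⟩ := f.onE.surjective e
          have e1 := f.aEnd_eq e
          have e2 := f'.aEnd_eq e
          rw [← h3, ← h1] at e2
          exact e1.trans e2.symm
        · obtain ⟨t, rfl⟩ := f.onT.surjective t
          have e1 := f.base_eq t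
          have e2 := f'.base_eq t
          rw [← h4, ← h1] at e2
          exact e1.trans e2.symm
      subst hγ ho hφ
      exact congrArg _ (BipGraph.Iso.ext h1 h2 h3 h4)
    · rintro ⟨fA, ⟨⟨σ, hσ⟩, ⟨ε, hε⟩⟩, ⟨τ, hτ⟩⟩
      have hend : ∀ s b, Γ.sEnd (ε.symm (s, b)) = σ.symm s := by
        intro s b
        rw [Equiv.eq_symm_apply, ← hε, Equiv.apply_symm_apply]
      let x : LabelledData cs T A :=
        (fun v => Γ.vGenus (fA.symm v),
          fun s => ⟨(Γ.edgeColor (ε.symm (s, false)), Γ.edgeColor (ε.symm (s, true))), by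
            rw [← Γ.pairColor_eq (ε.symm.injective.ne (by simp)) (hend s false) (hend s true),
              ← hσ, Equiv.apply_symm_apply]⟩,
          Sum.elim (fun e => fA (Γ.aEnd (ε.symm e))) fun t => fA (Γ.base (τ.symm t)))
      refine ⟨⟨x, ⟨fA, σ, ε, τ, ?_, hε, ?_, ?_, hτ, ?_⟩⟩, rfl⟩
      · intro e
        simp [labelledGraph, x]
      · intro t
        simp [labelledGraph, x]
      · intro e
        have : ∀ y : S × Bool, (labelledGraph ct x).edgeColor y = Γ.edgeColor (ε.symm y) := by
          rintro ⟨s, _ | _⟩ <;> rfl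
        rw [this, Equiv.symm_apply_apply]
      · intro v
        simp [labelledGraph, x]
  have cardA : Nat.card (A' ≃ A) = (Fintype.card A).factorial := by
    have := card_equiv_comp_eq (X := A') (Y := A) (C := Unit) (fun _ => ()) (fun _ => ())
      (fun _ => Fintype.card A) (fun c => by rw [← hA]; exact Nat.card_congr (Equiv.subtypeUnivEquiv fun _ => rfl))
      (fun c => by
        rw [← Nat.card_eq_fintype_card]; exact Nat.card_congr (Equiv.subtypeUnivEquiv fun _ => rfl))
    simpa using this
  have cardS : Nat.card Lab = ∏ p, (colorExponent cs ct (Sum.inl p)).factorial := by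
    refine card_equiv_comp_eq _ _ _ (fun p => ?_) (fun p => ?_)
    · rw [← hΓ, BipGraph.exponent_inl]
    · rw [colorExponent_inl]
  have cardT : Nat.card {τ : T' ≃ T // ∀ t, ct (τ t) = Γ.tailColor t} =
      ∏ i, (colorExponent cs ct (Sum.inr i)).factorial := by
    refine card_equiv_comp_eq _ _ _ (fun p => ?_) (fun p => ?_)
    · rw [← hΓ, BipGraph.exponent_inr]
    · rw [colorExponent_inr]
  have cardE : ∀ σ, Nat.card (Lab₂ σ) = 2 ^ Fintype.card S := by
    intro σ
    have := card_equiv_comp_eq (fun e => σ.1 (Γ.sEnd e)) (fun e : S × Bool => e.1) (fun _ => 2)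
      (fun s => by
        rw [← Γ.two_valent (σ.1.symm s)]
        exact Nat.card_congr (Equiv.subtypeEquivRight fun e => by rw [Equiv.eq_symm_apply]))
      card_fst_eq
    rw [this]
    simp
  have : ∀ σ, Finite (Lab₂ σ) := fun σ => Nat.finite_of_card_ne_zero (by rw [cardE]; positivity)
  have : Finite Lab := Nat.finite_of_card_ne_zero (by
    rw [cardS]; exact Finset.prod_ne_zero_iff.2 fun p _ => Nat.factorial_ne_zero _)
  have := Fintype.ofFinite Lab
  rw [Nat.card_congr (Equiv.ofBijective F hF), Nat.card_prod, Nat.card_prod, Nat.card_sigma,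
    Finset.sum_congr rfl fun σ _ => cardE σ, Finset.sum_const, Finset.card_univ,
    ← Nat.card_eq_fintype_card, cardA, cardS, cardT, Fintype.prod_sum_type, smul_eq_mul]
  ring

end Labellings

end

end ColoredGraphs

namespace ColoredGraphs

noncomputable section

/-! ### From isomorphism classes weighted by 1/|Aut| to labelled graphs. -/

section Counting

open scoped Classical

variable {r : ℕ} {S T A : Type} [Fintype S] [Fintype T] {cs : S → Sym2 (Fin r)} {ct : T → Fin r}

/-- Orbit counting: once an isomorphism to a given labelled graph is chosen, all the others arise
from it through the automorphisms of Γ. -/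
theorem card_labelledData_fiber [Fintype A] (Γ : FinGraph r) (hA : Γ.nA = Fintype.card A)
    (hΓ : Γ.graph.exponent = colorExponent cs ct) :
    Nat.card {x : LabelledData cs T A // Nonempty (BipGraph.Iso Γ.graph (labelledGraph ct x))} *
        Γ.graph.autCard =
      (Fintype.card A).factorial * (∏ v, (colorExponent cs ct v).factorial) *
        2 ^ Fintype.card S := by
  rw [← card_sigma_iso_labelledGraph Γ.graph (by simpa using hA) hΓ, BipGraph.autCard,
    ← Nat.card_prod]
  refine Nat.card_congr (Equiv.ofBijective
    (fun y => ⟨y.1.1, y.2.trans y.1.2.some⟩) ⟨?_, ?_⟩)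
  · rintro ⟨⟨x, hx⟩, f⟩ ⟨⟨x', hx'⟩, f'⟩ h
    obtain ⟨rfl, h⟩ := Sigma.mk.inj_iff.1 h
    have := (BipGraph.Iso.transEquiv hx.some).injective (eq_of_heq h)
    exact Prod.ext rfl this
  · rintro ⟨x, f⟩
    exact ⟨(⟨x, ⟨f⟩⟩, (BipGraph.Iso.transEquiv (Nonempty.intro f).some).symm f),
      Sigma.ext rfl (heq_of_eq ((BipGraph.Iso.transEquiv _).apply_symm_apply f))⟩

variable {R : Type*} [CommRing R]

/-- The weights `∑_g a_{g,N} ħ^g` of a vertex of valence `N`. -/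
def vertexSeries (a : ℕ → (Fin r →₀ ℕ) → R) (N : Fin r →₀ ℕ) : PowerSeries R :=
  PowerSeries.mk fun g => a g N

/-- The connected labelled graphs of genus `g` on `A`. -/
def genusData (cs : S → Sym2 (Fin r)) (T A : Type) [Fintype T] [Fintype A] (g : ℕ) :
    Finset (LabelledData cs T A) :=
  (if Fintype.card S + 1 - Fintype.card A ≤ g then
      Finset.piAntidiag Finset.univ (g - (Fintype.card S + 1 - Fintype.card A)) else ∅) ×ˢ
    Finset.univ ×ˢ Finset.univ.filter fun φ => ConnectedOn (glue S T) φ Finset.univ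

theorem mem_genusData [Fintype A] (ct : T → Fin r) {g : ℕ}
    {x : LabelledData cs T A} :
    x ∈ genusData cs T A g ↔
      (labelledGraph ct x).IsConnected ∧ (labelledGraph ct x).genus = (g : ℤ) := by
  rw [isConnected_labelledGraph_iff, genus_labelledGraph, genusData, Finset.mem_product,
    Finset.mem_product, Finset.mem_filter]
  simp only [Finset.mem_univ, true_and]
  rw [and_comm]
  refine and_congr_right fun h => ?_
  -- For a connected graph the natural-number subtraction is genuine, so the genus condition says
  -- that the vertex genera add up to g minus the loop number.
  have hle := card_le_of_connectedOn_glue h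
  obtain ⟨k, hk⟩ := Nat.exists_eq_add_of_le hle
  rw [← Nat.cast_sum, show Fintype.card S + 1 - Fintype.card A = k by omega]
  split_ifs with hg
  · simp only [Finset.mem_piAntidiag, Finset.mem_univ, implies_true, and_true]
    change (∑ v, x.1 v) = _ ↔ _
    generalize ∑ v, x.1 v = N
    omega
  · simp only [Finset.notMem_empty, false_iff]
    omega

/-- Expanding the product of the vertex series distributes the power of the variable over the
vertices as their genera, and the monomial in front supplies the loop number. -/
theorem coeff_X_pow_mul_labelledSum [Fintype A] (a : ℕ → (Fin r →₀ ℕ) → R) (g : ℕ) :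
    PowerSeries.coeff g (PowerSeries.X ^ (Fintype.card S + 1 - Fintype.card A) *
        labelledSum (vertexSeries a) cs ct A) =
      ∑ x ∈ genusData cs T A g, (labelledGraph ct x).vertexWeight a := by
  have hw : ∀ (o : Lift cs) (φ : HalfEdge S T → A) (n : ℕ),
      PowerSeries.coeff n (confWeight (vertexSeries a) (halfColor o ct) φ) =
        ∑ γ ∈ Finset.piAntidiag Finset.univ n,
          (labelledGraph ct ((γ, o, φ) : LabelledData cs T A)).vertexWeight a := by
    intro o φ n
    rw [confWeight, PowerSeries.coeff_prod]
    refine Finset.sum_nbij' (fun γ => ⇑γ) Finsupp.equivFunOnFinite.symm (by simp) (by simp)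
      (by simp) (by simp) fun γ _ => Finset.prod_congr rfl fun v _ => ?_
    rw [valence_labelledGraph, vertexSeries, PowerSeries.coeff_mk]
    rfl
  rw [PowerSeries.coeff_X_pow_mul', genusData]
  split_ifs with h
  · rw [Finset.sum_product, labelledSum, map_sum, Finset.sum_comm, Finset.sum_product]
    refine Finset.sum_congr rfl fun o _ => ?_
    rw [confSum_eq, map_sum, Finset.sum_filter]
    refine Finset.sum_congr rfl fun φ _ => ?_
    split_ifs
    · exact hw o φ _
    · exact map_zero _
  · simp

variable [Algebra ℚ R]

/-- The coefficients of the genus expansion count graphs with labelled `s`-vertices and tails. -/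
theorem factorial_smul_coeff_genusTerm (a : ℕ → (Fin r →₀ ℕ) → R) (g : ℕ)
    (cs : S → Sym2 (Fin r)) (ct : T → Fin r) :
    ((∏ v, (colorExponent cs ct v).factorial : ℕ) : ℚ) •
        MvPowerSeries.coeff (colorExponent cs ct) (genusTerm a g) =
      PowerSeries.coeff g (genusSeries PowerSeries.X (vertexSeries a) cs ct) := by
  set D := ∏ v, (colorExponent cs ct v).factorial
  have hD : (D : ℚ) ≠ 0 := Nat.cast_ne_zero.2
    (Finset.prod_ne_zero_iff.2 fun v _ => Nat.factorial_ne_zero _)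
  -- All connected labelled graphs of genus g with the given colors, over every possible number of
  -- `a`-vertices; a finite set that maps onto the classes contributing to this coefficient.
  let Big : Finset (Σ m : ℕ, LabelledData cs T (Fin m)) :=
    (Finset.range (Fintype.card S + 2)).sigma fun m => genusData cs T (Fin m) g
  let q : (Σ m : ℕ, LabelledData cs T (Fin m)) → GraphClass r :=
    fun y => (labelledGraph ct y.2).toClass
  have hq : ∀ y c, q y = c ↔ Nonempty (BipGraph.Iso c.rep.graph (labelledGraph ct y.2)) :=
    fun y c => BipGraph.toClass_eq_iff _ c
  have hBig : ∀ y, y ∈ Big ↔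
      (labelledGraph ct y.2).IsConnected ∧ (labelledGraph ct y.2).genus = (g : ℤ) := by
    rintro ⟨m, x⟩
    rw [Finset.mem_sigma, mem_genusData ct, Finset.mem_range]
    refine and_iff_right_of_imp fun h => ?_
    have := card_le_of_connectedOn_glue ((isConnected_labelledGraph_iff x).1 h.1)
    rw [Fintype.card_fin] at this
    exact Nat.lt_succ_of_le this
  have hC : ∀ c : GraphClass r, (c.rep.graph.IsConnected ∧
      c.rep.graph.genus = (g : ℤ) ∧ c.rep.graph.exponent = colorExponent cs ct) ↔
      c ∈ Big.image q := by
    intro c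
    rw [Finset.mem_image]
    constructor
    · rintro ⟨h1, h2, h3⟩
      have hcard := card_labelledData_fiber (A := Fin c.rep.nA) c.rep (by simp) h3
      have hne : Nat.card {x : LabelledData cs T (Fin c.rep.nA) //
          Nonempty (BipGraph.Iso c.rep.graph (labelledGraph ct x))} ≠ 0 := by
        intro h
        rw [h, zero_mul] at hcard
        refine (mul_ne_zero (mul_ne_zero (Nat.factorial_ne_zero _) ?_) ?_) hcard.symm
        · exact Nat.cast_ne_zero.1 hD
        · positivity
      obtain ⟨⟨x, hx⟩⟩ := (Nat.card_ne_zero.1 hne).1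
      refine ⟨⟨c.rep.nA, x⟩, (hBig _).2 ?_, (hq _ _).2 hx⟩
      obtain ⟨f⟩ := hx
      exact ⟨f.isConnected_iff.1 h1, f.genus_eq.symm.trans h2⟩
    · rintro ⟨y, hy, hyc⟩
      obtain ⟨f⟩ := (hq y c).1 hyc
      rw [hBig] at hy
      exact ⟨f.isConnected_iff.2 hy.1, f.genus_eq.trans hy.2,
        f.exponent_eq.trans (exponent_labelledGraph _)⟩
  -- All members of a class have the same number of `a`-vertices and the same weight, so a fiber
  -- contributes its cardinality times one term.
  have hfib : ∀ c ∈ Big.image q,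
      ∑ y ∈ Big with q y = c,
        (1 / (y.1.factorial : ℚ)) • (labelledGraph ct y.2).vertexWeight a =
      (D * 2 ^ Fintype.card S : ℚ) • (1 / (c.rep.graph.autCard : ℚ)) •
        c.rep.graph.vertexWeight a := by
    intro c hc
    obtain ⟨h1, h2, h3⟩ := (hC c).2 hc
    have hcard := card_labelledData_fiber (A := Fin c.rep.nA) c.rep (by simp) h3
    have haut : (c.rep.graph.autCard : ℚ) ≠ 0 := Nat.cast_ne_zero.2 BipGraph.autCard_pos.ne'
    have hnA : ∀ y, q y = c → y.1 = c.rep.nA := by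
      intro y hy
      obtain ⟨f⟩ := (hq y c).1 hy
      simpa using (Fintype.card_congr f.onA).symm
    have hterm : ∀ y ∈ Big.filter fun y => q y = c,
        (1 / (y.1.factorial : ℚ)) • (labelledGraph ct y.2).vertexWeight a =
        (1 / (c.rep.nA.factorial : ℚ)) • c.rep.graph.vertexWeight a := by
      intro y hy
      have hyc := (Finset.mem_filter.1 hy).2
      obtain ⟨f⟩ := (hq y c).1 hyc
      exact congrArg₂ (· • ·) (by rw [hnA y hyc]) (f.vertexWeight_eq a).symm
    have hcount : (Big.filter fun y => q y = c).card =
        Nat.card {x : LabelledData cs T (Fin c.rep.nA) //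
          Nonempty (BipGraph.Iso c.rep.graph (labelledGraph ct x))} := by
      have hmem : ∀ y, y ∈ Big.filter (fun y => q y = c) ↔
          Nonempty (BipGraph.Iso c.rep.graph (labelledGraph ct y.2)) := by
        intro y
        rw [Finset.mem_filter, hq]
        refine and_iff_right_of_imp fun ⟨f⟩ => (hBig y).2 ?_
        exact ⟨f.isConnected_iff.1 h1, f.genus_eq.symm.trans h2⟩
      rw [← Fintype.card_coe, ← Nat.card_eq_fintype_card]
      refine (Nat.card_congr (Equiv.ofBijective
        (fun x => ⟨⟨c.rep.nA, x.1⟩, (hmem _).2 x.2⟩) ⟨fun x x' h => ?_, ?_⟩)).symm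
      · have h' := (Sigma.mk.inj_iff.1 (Subtype.mk.inj h)).2
        exact Subtype.ext (eq_of_heq h')
      · rintro ⟨⟨m, x⟩, hx⟩
        obtain rfl : m = c.rep.nA := hnA ⟨m, x⟩ ((hq _ _).2 ((hmem _).1 hx))
        exact ⟨⟨x, (hmem _).1 hx⟩, rfl⟩
    rw [Finset.sum_congr rfl hterm, Finset.sum_const, hcount, ← Nat.cast_smul_eq_nsmul ℚ, smul_smul,
      smul_smul]
    congr 1
    rw [Fintype.card_fin] at hcard
    have hcard' := congrArg (Nat.cast (R := ℚ)) hcard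
    push_cast at hcard'
    have hfac : (c.rep.nA.factorial : ℚ) ≠ 0 := Nat.cast_ne_zero.2 (Nat.factorial_ne_zero _)
    field_simp
    simp only [D]
    push_cast
    linear_combination hcard'
  have hlhs : MvPowerSeries.coeff (colorExponent cs ct) (genusTerm a g) =
      ∑ c ∈ Big.image q, (1 / (c.rep.graph.autCard : ℚ)) • c.rep.graph.vertexWeight a := by
    have hset : {c : GraphClass r | c.rep.graph.IsConnected ∧ c.rep.graph.genus = (g : ℤ) ∧
        c.rep.graph.exponent = colorExponent cs ct} = (Big.image q : Set (GraphClass r)) :=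
      Set.ext fun c => (hC c).trans Finset.mem_coe.symm
    change (∑ᶠ c ∈ {c : GraphClass r | c.rep.graph.IsConnected ∧ c.rep.graph.genus = (g : ℤ) ∧
        c.rep.graph.exponent = colorExponent cs ct}, _) = _
    rw [hset, finsum_mem_coe_finset]
  have hsum : PowerSeries.coeff g (genusSeries PowerSeries.X (vertexSeries a) cs ct) =
      (1 / 2 : ℚ) ^ Fintype.card S • ∑ y ∈ Big,
        (1 / (y.1.factorial : ℚ)) • (labelledGraph ct y.2).vertexWeight a := by
    have hsmul : ∀ (c : ℚ) (f : PowerSeries R),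
        PowerSeries.coeff g (c • f) = c • PowerSeries.coeff g f := fun c f => rfl
    rw [genusSeries, hsmul, map_sum, Finset.sum_sigma]
    congr 1
    refine Finset.sum_congr rfl fun m _ => ?_
    have := coeff_X_pow_mul_labelledSum (A := Fin m) (cs := cs) (ct := ct) a g
    rw [Fintype.card_fin] at this
    rw [hsmul, this, Finset.smul_sum]
  rw [hsum, hlhs, ← Finset.sum_fiberwise_of_maps_to fun y hy => Finset.mem_image_of_mem q hy,
    Finset.sum_congr rfl hfib, ← Finset.smul_sum, smul_smul]
  congr 1
  rw [mul_left_comm, ← mul_pow]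
  norm_num

end Counting

end

end ColoredGraphs

namespace ColoredGraphs

noncomputable section

/-! ### Coefficients normalized by factorials. -/

section NormalizedCoeff

variable {σ : Type*} [Fintype σ] {R : Type*} [CommRing R] [Algebra ℚ R]

/-- The coefficient of `∏ x_v^{d_v} / d_v!`. -/
def normalizedCoeff (f : MvPowerSeries σ R) (d : σ →₀ ℕ) : R :=
  ((∏ v, (d v).factorial : ℕ) : ℚ) • MvPowerSeries.coeff d f

theorem normalizedCoeff_add (f g : MvPowerSeries σ R) (d : σ →₀ ℕ) :
    normalizedCoeff (f + g) d = normalizedCoeff f d + normalizedCoeff g d := by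
  rw [normalizedCoeff, map_add, smul_add]
  rfl

theorem normalizedCoeff_smul (c : ℚ) (f : MvPowerSeries σ R) (d : σ →₀ ℕ) :
    normalizedCoeff (c • f) d = c • normalizedCoeff f d :=
  smul_comm _ c _

theorem ext_normalizedCoeff {f g : MvPowerSeries σ R}
    (h : ∀ d, normalizedCoeff f d = normalizedCoeff g d) : f = g := by
  ext d
  have hd : ((∏ v, (d v).factorial : ℕ) : ℚ) ≠ 0 := Nat.cast_ne_zero.2
    (Finset.prod_ne_zero_iff.2 fun v _ => Nat.factorial_ne_zero _)
  have := congrArg (((∏ v, (d v).factorial : ℕ) : ℚ)⁻¹ • ·) (h d)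
  simpa only [normalizedCoeff, inv_smul_smul₀ hd] using this

theorem normalizedCoeff_pderiv (v : σ) (f : MvPowerSeries σ R) (d : σ →₀ ℕ) :
    normalizedCoeff (MvPowerSeries.pderiv R v f) d = normalizedCoeff f (d + Finsupp.single v 1) := by
  classical
  have hprod : ∏ w, ((d + Finsupp.single v 1 : σ →₀ ℕ) w).factorial =
      (∏ w, (d w).factorial) * (d v + 1) := by
    rw [← Finset.mul_prod_erase _ _ (Finset.mem_univ v),
      ← Finset.mul_prod_erase _ (fun w => (d w).factorial) (Finset.mem_univ v),
      Finset.prod_congr rfl (g := fun w => (d w).factorial) fun w hw => by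
        simp [(Finset.ne_of_mem_erase hw).symm]]
    simp only [Finsupp.add_apply, Finsupp.single_eq_same, Nat.factorial_succ]
    ring
  rw [normalizedCoeff, normalizedCoeff, MvPowerSeries.coeff_pderiv, hprod, Nat.cast_mul, mul_smul]
  congr 1
  rw [Nat.cast_smul_eq_nsmul, nsmul_eq_mul, mul_comm]
  push_cast
  rfl

/-- The Leibniz rule for a list of labelled variables. -/
theorem normalizedCoeff_mul {L : Type*} [DecidableEq L] (c : L → σ) (A : Finset L)
    (f g : MvPowerSeries σ R) :
    normalizedCoeff (f * g) (∑ l ∈ A, Finsupp.single (c l) 1) =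
      ∑ B ∈ A.powerset, normalizedCoeff f (∑ l ∈ B, Finsupp.single (c l) 1) *
        normalizedCoeff g (∑ l ∈ A \ B, Finsupp.single (c l) 1) := by
  induction A using Finset.induction_on generalizing f g with
  | empty => simp [normalizedCoeff]
  | insert a A ha ih =>
    rw [Finset.sum_insert ha, add_comm, ← normalizedCoeff_pderiv, Derivation.leibniz,
      smul_eq_mul, smul_eq_mul, normalizedCoeff_add, mul_comm g, ih, ih,
      Finset.sum_powerset_insert ha]
    refine congrArg₂ _ ?_ ?_
    · refine Finset.sum_congr rfl fun B hB => ?_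
      have haB : a ∉ B := fun h => ha (Finset.mem_powerset.1 hB h)
      rw [normalizedCoeff_pderiv, Finset.insert_sdiff_of_notMem _ haB,
        Finset.sum_insert (fun h => ha (Finset.mem_sdiff.1 h).1), add_comm (Finsupp.single _ _)]
    · refine Finset.sum_congr rfl fun B hB => ?_
      have haB : a ∉ B := fun h => ha (Finset.mem_powerset.1 hB h)
      rw [normalizedCoeff_pderiv, Finset.sum_insert haB, add_comm (Finsupp.single _ _),
        Finset.insert_sdiff_insert, Finset.sdiff_insert_of_notMem ha]

end NormalizedCoeff

/-! ### Exponents realized by labelled sets of `s`-vertices and tails. -/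

section ColorExponent

open scoped Classical

variable {r : ℕ} {R : Type*} [CommRing R] [Algebra ℚ R] {S T : Type} [Fintype S] [Fintype T]

theorem colorExponent_option_left (p : Sym2 (Fin r)) (cs : S → Sym2 (Fin r)) (ct : T → Fin r) :
    colorExponent (fun x : Option S => x.elim p cs) ct =
      colorExponent cs ct + Finsupp.single (Sum.inl p) 1 := by
  simp only [colorExponent, Fintype.sum_option, Option.elim]
  abel

theorem colorExponent_option_right (i : Fin r) (cs : S → Sym2 (Fin r)) (ct : T → Fin r) :
    colorExponent cs (fun x : Option T => x.elim i ct) =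
      colorExponent cs ct + Finsupp.single (Sum.inr i) 1 := by
  simp only [colorExponent, Fintype.sum_option, Option.elim]
  abel

/-- Hence an identity of series may be tested on colored label sets, where new variables are new
labels. -/
theorem exists_colorExponent_eq (d : Sym2 (Fin r) ⊕ Fin r →₀ ℕ) :
    ∃ (S T : Type) (_ : Fintype S) (_ : Fintype T) (cs : S → Sym2 (Fin r)) (ct : T → Fin r),
      colorExponent cs ct = d := by
  refine ⟨Σ p, Fin (d (Sum.inl p)), Σ i, Fin (d (Sum.inr i)), inferInstance, inferInstance,
    Sigma.fst, Sigma.fst, ?_⟩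
  ext (p | i)
  · simp [colorExponent, Fintype.sum_sigma, Finsupp.single_apply]
  · simp [colorExponent, Fintype.sum_sigma, Finsupp.single_apply]

/-- With factorial normalization a product distributes the labels over two parts without binomial
factors, the same form as the separating term of the cut. -/
theorem normalizedCoeff_mul_colorExponent (cs : S → Sym2 (Fin r)) (ct : T → Fin r)
    (f g : SXSeries r R) :
    normalizedCoeff (f * g) (colorExponent cs ct) =
      ∑ X : Finset S, ∑ Y : Finset T,
        normalizedCoeff f
            (colorExponent (fun s : {s // s ∈ X} => cs s) (fun t : {t // t ∈ Y} => ct t)) *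
          normalizedCoeff g
            (colorExponent (fun s : {s // s ∉ X} => cs s) (fun t : {t // t ∉ Y} => ct t)) := by
  have hU : colorExponent cs ct =
      ∑ l ∈ (Finset.univ : Finset (S ⊕ T)), Finsupp.single (Sum.map cs ct l) 1 := by
    simp [colorExponent, Fintype.sum_sum_type]
  rw [hU, normalizedCoeff_mul, Finset.powerset_univ, ← Finset.sum_product']
  refine Finset.sum_nbij' (fun B => (B.toLeft, B.toRight)) (fun B => B.1.disjSum B.2) (by simp)
    (by simp) (fun B _ => Finset.toLeft_disjSum_toRight) (by simp) fun B _ => ?_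
  congr 2
  · have : B = B.toLeft.disjSum B.toRight := Finset.toLeft_disjSum_toRight.symm
    rw [colorExponent, this, Finset.sum_disjSum, ← this]
    simp only [Sum.map_inl, Sum.map_inr]
    rw [Finset.sum_subtype B.toLeft (p := fun s => s ∈ B.toLeft) (by simp),
      Finset.sum_subtype B.toRight (p := fun s => s ∈ B.toRight) (by simp)]
  · have : Finset.univ \ B = (B.toLeftᶜ).disjSum (B.toRightᶜ) := by
      ext (x | x) <;> simp
    rw [colorExponent, this, Finset.sum_disjSum]
    simp only [Sum.map_inl, Sum.map_inr]
    rw [Finset.sum_subtype (B.toLeftᶜ) (p := fun s => s ∉ B.toLeft) (by simp),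
      Finset.sum_subtype (B.toRightᶜ) (p := fun s => s ∉ B.toRight) (by simp)]

end ColorExponent

end

end ColoredGraphs

namespace ColoredGraphs

noncomputable section

/-! ### The differential equations and initial values of the genus terms. -/

section GenusEquations

open scoped Classical

variable {R : Type*} [CommRing R]

theorem coeff_zero_mul_powerSeries (f g : PowerSeries R) :
    PowerSeries.coeff 0 (f * g) = PowerSeries.coeff 0 f * PowerSeries.coeff 0 g := by
  simp [PowerSeries.coeff_mul]

theorem coeff_one_mul_powerSeries (f g : PowerSeries R) :
    PowerSeries.coeff 1 (f * g) = PowerSeries.coeff 0 f * PowerSeries.coeff 1 g +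
      PowerSeries.coeff 1 f * PowerSeries.coeff 0 g := by
  simp [PowerSeries.coeff_mul, Finset.Nat.antidiagonal_succ]

variable {r : ℕ} [Algebra ℚ R] {S T : Type} [Fintype S] [Fintype T]

/-- A symmetric function is summed over the ordered pairs with given underlying unordered pair. -/
theorem half_sum_lifts {M : Type*} [AddCommGroup M] [Module ℚ M] (G : Fin r → Fin r → M)
    (hG : ∀ i j, G i j = G j i) (i j : Fin r) :
    (1 / 2 : ℚ) • ∑ ij : {ij : Fin r × Fin r // s(ij.1, ij.2) = s(i, j)}, G ij.1.1 ij.1.2 =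
      (1 / (multiFactorial (Finsupp.single i 1 + Finsupp.single j 1) : ℚ)) • G i j := by
  -- For i ≠ j two orders share the factor 1/2, for i = j there is one order only; this is the
  -- origin of 1/{ij}!.
  rw [multiFactorial_single_add_single,
    ← Finset.sum_subtype {(i, j), (j, i)} (by simp)
      (fun ij : Fin r × Fin r => G ij.1 ij.2)]
  split_ifs with h
  · subst h
    simp
  · rw [Finset.sum_pair (by simp [h]), hG j i, ← two_smul ℚ, smul_smul]
    norm_num

theorem normalizedCoeff_genusTerm (a : ℕ → (Fin r →₀ ℕ) → R) (g : ℕ)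
    (cs : S → Sym2 (Fin r)) (ct : T → Fin r) :
    normalizedCoeff (genusTerm a g) (colorExponent cs ct) =
      PowerSeries.coeff g (genusSeries PowerSeries.X (vertexSeries a) cs ct) :=
  factorial_smul_coeff_genusTerm a g cs ct

theorem normalizedCoeff_dx (i : Fin r) (f : SXSeries r R) (cs : S → Sym2 (Fin r))
    (ct : T → Fin r) :
    normalizedCoeff (dx i f) (colorExponent cs ct) =
      normalizedCoeff f (colorExponent cs fun x : Option T => x.elim i ct) := by
  rw [dx, normalizedCoeff_pderiv, colorExponent_option_right]

theorem normalizedCoeff_dx_mul_dx (i j : Fin r) (f g : SXSeries r R) (cs : S → Sym2 (Fin r))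
    (ct : T → Fin r) :
    normalizedCoeff (dx i f * dx j g) (colorExponent cs ct) =
      ∑ X : Finset S, ∑ Y : Finset T,
        normalizedCoeff f (colorExponent (fun s : {s // s ∈ X} => cs s)
            fun x : Option {t // t ∈ Y} => x.elim i fun t => ct t) *
          normalizedCoeff g (colorExponent (fun s : {s // s ∉ X} => cs s)
            fun x : Option {t // t ∉ Y} => x.elim j fun t => ct t) := by
  simp only [normalizedCoeff_mul_colorExponent, normalizedCoeff_dx]

theorem normalizedCoeff_ds_genusTerm (a : ℕ → (Fin r →₀ ℕ) → R) (g : ℕ) (i j : Fin r)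
    (cs : S → Sym2 (Fin r)) (ct : T → Fin r) :
    normalizedCoeff (ds i j (genusTerm a g)) (colorExponent cs ct) =
      PowerSeries.coeff g (genusSeries PowerSeries.X (vertexSeries a)
        (fun x : Option S => x.elim s(i, j) cs) ct) := by
  rw [ds, normalizedCoeff_pderiv, ← colorExponent_option_left, normalizedCoeff_genusTerm]

theorem coeff_rat_smul_powerSeries (n : ℕ) (c : ℚ) (f : PowerSeries R) :
    PowerSeries.coeff n (c • f) = c • PowerSeries.coeff n f := rfl

/-- The tree term of the genus expansion satisfies the genus zero equations. -/
theorem genusZeroEquations_genusTerm (a : ℕ → (Fin r →₀ ℕ) → R) :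
    GenusZeroEquations (genusTerm a 0) := by
  refine fun i j => ext_normalizedCoeff fun d => ?_
  obtain ⟨S, T, _, _, cs, ct, rfl⟩ := exists_colorExponent_eq d
  rw [normalizedCoeff_ds_genusTerm, genusSeries_option, coeff_rat_smul_powerSeries, map_sum,
    normalizedCoeff_smul,
    ← half_sum_lifts (fun i j => normalizedCoeff
      (gradient (genusTerm a 0) i * gradient (genusTerm a 0) j) (colorExponent cs ct))
      fun i j => by rw [mul_comm]]
  congr 1
  refine Finset.sum_congr rfl fun ij _ => ?_
  -- The nonseparating term carries a factor of the genus variable and disappears in genus zero.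
  simp only [gradient, normalizedCoeff_dx_mul_dx, normalizedCoeff_genusTerm, map_add, map_sum,
    PowerSeries.coeff_zero_X, zero_mul, zero_add, coeff_zero_mul_powerSeries]

/-- The genus one term of the genus expansion satisfies the genus one equations. -/
theorem genusOneEquations_genusTerm (a : ℕ → (Fin r →₀ ℕ) → R) :
    GenusOneEquations (genusTerm a 0) (genusTerm a 1) := by
  refine fun i j => ext_normalizedCoeff fun d => ?_
  obtain ⟨S, T, _, _, cs, ct, rfl⟩ := exists_colorExponent_eq d
  rw [normalizedCoeff_ds_genusTerm, genusSeries_option, coeff_rat_smul_powerSeries, map_sum,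
    normalizedCoeff_smul,
    ← half_sum_lifts (fun i j => normalizedCoeff
      (dx i (dx j (genusTerm a 0)) + gradient (genusTerm a 0) i * dx j (genusTerm a 1) +
        gradient (genusTerm a 0) j * dx i (genusTerm a 1)) (colorExponent cs ct))
      fun i j => by
        rw [add_right_comm, show dx i (dx j (genusTerm a 0)) = _ from pderiv_comm _ _ _]
        rfl]
  congr 1
  refine Finset.sum_congr rfl fun ij _ => ?_
  -- Derivatives and factors are reordered to match the cut: the tail of the first color belongs to
  -- the first part, and new tails are added from the outermost derivative inwards.
  rw [mul_comm (gradient (genusTerm a 0) ij.1.2),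
    show dx ij.1.1 (dx ij.1.2 (genusTerm a 0)) = dx ij.1.2 (dx ij.1.1 (genusTerm a 0)) from
      pderiv_comm _ _ _]
  -- The loop variable lowers the nonseparating term to genus zero, and in the separating term the
  -- genus-one side is one of the two parts.
  simp only [gradient, normalizedCoeff_add, normalizedCoeff_dx_mul_dx, normalizedCoeff_dx,
    normalizedCoeff_genusTerm, map_add, map_sum,
    show ∀ f : PowerSeries R, PowerSeries.coeff 1 (PowerSeries.X * f) = PowerSeries.coeff 0 f from
      PowerSeries.coeff_succ_X_mul 0, coeff_one_mul_powerSeries, Finset.sum_add_distrib, add_assoc]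

/-- Without `s`-vertices a connected graph is a single vertex carrying all the tails, so only m = 1
survives in the generating series. -/
theorem atSZero_genusTerm (a : ℕ → (Fin r →₀ ℕ) → R) (g : ℕ) :
    atSZero (genusTerm a g) = potential a g := by
  ext N
  have hfac : (multiFactorial N : ℚ) ≠ 0 := Nat.cast_ne_zero.2
    (Finset.prod_ne_zero_iff.2 fun v _ => Nat.factorial_ne_zero _)
  have hexp : xExponent N =
      colorExponent (Empty.elim : Empty → Sym2 (Fin r)) (Sigma.fst : (Σ i, Fin (N i)) → Fin r) := by
    ext (p | i)
    · rw [colorExponent, xExponent, Finsupp.mapDomain_of_notMem_range _ _ (by simp)]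
      simp
    · rw [colorExponent, xExponent, Finsupp.mapDomain_apply Sum.inr_injective]
      simp [Fintype.sum_sigma, Finsupp.single_apply]
  have hN : ∏ v, (xExponent N v).factorial = multiFactorial N := by
    rw [Fintype.prod_sum_type, multiFactorial]
    simp [xExponent, Finsupp.mapDomain_apply Sum.inr_injective, Finsupp.mapDomain_of_notMem_range]
  have hpot : MvPowerSeries.coeff N (potential a g) = (1 / (multiFactorial N : ℚ)) • a g N := rfl
  have key := factorial_smul_coeff_genusTerm a g (Empty.elim : Empty → Sym2 (Fin r))
    (Sigma.fst : (Σ i, Fin (N i)) → Fin r)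
  rw [← hexp, hN, ← coeff_atSZero] at key
  have hval : ∀ (φ : HalfEdge Empty (Σ i, Fin (N i)) → Fin 1)
      (o : Lift (Empty.elim : Empty → Sym2 (Fin r))),
      confValence (halfColor o (Sigma.fst : (Σ i, Fin (N i)) → Fin r)) φ 0 = N := by
    intro φ o
    ext i
    simp_rw [confValence_eq, if_pos (Subsingleton.elim (φ _) 0)]
    simp [halfColor, Fintype.sum_sum_type, Fintype.sum_sigma]
  have hser : genusSeries PowerSeries.X (vertexSeries a) (Empty.elim : Empty → Sym2 (Fin r))
      (Sigma.fst : (Σ i, Fin (N i)) → Fin r) = vertexSeries a N := by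
    have h0 : labelledSum (vertexSeries a) (Empty.elim : Empty → Sym2 (Fin r))
      (Sigma.fst : (Σ i, Fin (N i)) → Fin r) (Fin 0) = 0 :=
      Finset.sum_eq_zero fun o _ => Finset.sum_eq_zero fun φ _ => if_neg fun hφ => by
        simpa using hφ.1
    have h1 : labelledSum (vertexSeries a) (Empty.elim : Empty → Sym2 (Fin r))
      (Sigma.fst : (Σ i, Fin (N i)) → Fin r) (Fin 1) = vertexSeries a N := by
      rw [labelledSum, Fintype.sum_unique, confSum_eq, Fintype.sum_unique, if_pos, confWeight,
        Fin.prod_univ_one, hval]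
      refine ⟨Finset.univ_nonempty, fun P _ _ => P.eq_empty_or_nonempty.imp_right ?_⟩
      rintro ⟨x, hx⟩
      exact Finset.eq_univ_iff_forall.2 fun y => Subsingleton.elim x y ▸ hx
    simp [genusSeries, Finset.sum_range_succ, h0, h1]
  rw [hser, vertexSeries, PowerSeries.coeff_mk] at key
  rw [hpot, ← key, smul_smul, one_div_mul_cancel hfac, one_smul]

end GenusEquations

end

end ColoredGraphs

theorem theorem1p5 {r : ℕ} {R : Type*} [CommRing R] [Algebra ℚ R]
    (a : ℕ → (Fin r →₀ ℕ) → R) :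
    ColoredGraphs.genusTerm a 1 =
        ColoredGraphs.oneLoop (ColoredGraphs.potential a 0) (ColoredGraphs.potential a 1)
          (ColoredGraphs.gradient (ColoredGraphs.genusTerm a 0)) ∧
      ∀ Psi1 : ColoredGraphs.SXSeries r R,
        (ColoredGraphs.GenusOneEquations (ColoredGraphs.genusTerm a 0) Psi1 ∧
            ColoredGraphs.atSZero Psi1 = ColoredGraphs.potential a 1) ↔
          Psi1 = ColoredGraphs.oneLoop (ColoredGraphs.potential a 0)
            (ColoredGraphs.potential a 1)
            (ColoredGraphs.gradient (ColoredGraphs.genusTerm a 0)) := by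
  have h := fun Psi1 => (ColoredGraphs.genusZeroEquations_genusTerm a).genusOne_iff
    (ColoredGraphs.atSZero_genusTerm a 0) (ColoredGraphs.potential a 1) Psi1
  -- The closed formula is the uniqueness statement applied to the genus one term itself.
  exact ⟨(h _).1 ⟨ColoredGraphs.genusOneEquations_genusTerm a,
    ColoredGraphs.atSZero_genusTerm a 1⟩, h⟩
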